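/- Let $k$ be a field of characteristic zero and let $V=V_0\oplus V_1$ be a $\mathbb Z_2$-graded Lie algebra over $k$ with even bracket $l=[\cdot,\cdot]$, i.e. $[a,b]=-(-1)^{ab}[b,a]$ and $[a,[b,c]]=[[a,b],c]+(-1)^{ab}[b,[a,c]]$. Let $C(V)=\prod_{n\ge 1}\mathrm{Hom}(\bigwedge^nV,V)$ (graded exterior powers) and let $d$ be the Lie algebra coboundary operator: for $\varphi\in \mathrm{Hom}(\bigwedge^nV,V)$, $$d\varphi(v_1,\dots,v_{n+1})=\sum_{\sigma\in \mathrm{Sh}(2,n-1)}(-1)^\sigma\epsilon(\sigma;v)\,\varphi([v_{\sigma(1)},v_{\sigma(2)}],v_{\sigma(3)},\dots,v_{\sigma(n+1)})-(-1)^{n-1}\sum_{\sigma\in \mathrm{Sh}(n,1)}(-1)^\sigma\epsilon(\sigma;v)\,[\varphi(v_{\sigma(1)},\dots,v_{\sigma(n)}),v_{\sigma(n+1)}],$$ where $\mathrm{Sh}$ denotes unshuffles and $\epsilon(\sigma;v)$ is the Koszul sign. Let $C(V)_q$ consist of the $\varphi=(\varphi_n)$ with $|\varphi_n|=q+n-1$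 in $\mathbb Z_2$; then $d$ maps $C(V)_{q}$ to $C(V)_{q+1}$ and $d^2=0$; put $H(V)_q=\ker (d|_{C(V)_q})/d(C(V)_{q+1})$, so that $H(V)=H(V)_0\oplus H(V)_1=\prod_{n\ge1}H^n(V)$ is the Lie algebra cohomology of $V$ with adjoint coefficients (there are no cochains of degree $0$). Let $W=\Pi V$ be the parity reversion and $\bigodot W=\bigoplus_{n\ge1}\bigodot^nW$ the graded symmetric coalgebra. For $\delta$ a coderivation of $\bigodot W$ inducing $\delta_n:\bigodot^nW\to W$, let $\varphi_n=\eta_1^{-1}\circ\delta_n\circ\eta_n$, where $\eta_n(v_1\wedge\dots\wedge v_n)=(-1)^{(n-1)v_1+\dots+v_{n-1}}\pi v_1\odot\dots\odot\pi v_n$. An $L_\infty$ structure on $V$ is an odd coderivation $D$ of $\bigodot W$ with $D^2=0$. Then: (0) $\delta\mapsto(\varphi_n)$ is a bijection from the coderivations of parity $q$ onto $C(V)_q$, and there is exactly one $L_\infty$ structure $D$ on $V$ with structure maps $l_2=l$ and $l_n=0$ for $n\ne2$. (1) Under this bijection, the $L_\infty$ coboundary operator $\delta\mapsto[\delta,D]=\delta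 D-(-1)^{\delta}D\delta$ coincides up to a sign with $d$; with the conventions above the two operators are equal. (2) $H(V)$ classifies the infinitesimal deformations of the Lie algebra into an $L_\infty$ algebra: let $t$ be a parameter of parity $p\in\mathbb Z_2$ with $t^2=0$, graded commuting with $\bigodot W$. An infinitesimal deformation is an odd $k[t]$-linear codifferential $D_t$ of $\bigodot W\otimes k[t]$ with $D_t\equiv D$ modulo $t$. Two of them are equivalent if an even $k[t]$-linear coalgebra automorphism of $\bigodot W\otimes k[t]$ that is the identity modulo $t$ takes one to the other; this is an equivalence relation. Writing $D_t=D+t\delta$ on $\bigodot W$ and letting $\varphi$ be the cochain of $\delta$, the assignment $D_t\mapsto\varphi$ is a bijection from the infinitesimal deformations onto the cocycles in $C(V)_{p+1}$, and it induces a bijection between equivalence classes of infinitesimal deformations with parameter of parity $p$ and $H(V)_{p+1}$. -/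

import Mathlib

open scoped TensorProduct DirectSum

noncomputable section

namespace SuperLie

/-! ### Super vector spaces: modules with a grading by the integers modulo 2 -/

section Graded

variable {k M : Type*} [Field k] [AddCommGroup M] [Module k M]
variable (𝒱 : ZMod 2 → Submodule k M) [DirectSum.Decomposition 𝒱]

/-- The projection onto the homogeneous component of parity `i`. -/
def proj (i : ZMod 2) : M →ₗ[k] M :=
  (𝒱 i).subtype ∘ₗ DirectSum.component k (ZMod 2) (fun j => 𝒱 j) i ∘ₗ
    (DirectSum.decomposeLinearEquiv 𝒱).toLinearMap

/-- The map `v ↦ (-1)^{q|v|} v` (for homogeneous `v`): the sign that appears when a map or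
a parameter of parity `q` moves past `v`. -/
def koszul (q : ZMod 2) : M →ₗ[k] M :=
  ∑ i : ZMod 2, (-1 : ℤˣ) ^ (i * q) • proj 𝒱 i

/-- The parity reversion `Π V`: the same space with the parity of elements reversed. -/
def parityRev (i : ZMod 2) : Submodule k M := 𝒱 (i + 1)

theorem proj_of_mem {i j : ZMod 2} {x : M} (hx : x ∈ 𝒱 i) :
    proj 𝒱 j x = if j = i then x else 0 := by
  have : proj 𝒱 j x = (DirectSum.decompose 𝒱 x j : M) := rfl
  rw [this]
  split_ifs with h
  · subst h; exact DirectSum.decompose_of_mem_same 𝒱 hx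
  · exact DirectSum.decompose_of_mem_ne 𝒱 hx (Ne.symm h)

theorem koszul_of_mem {i : ZMod 2} (q : ZMod 2) {x : M} (hx : x ∈ 𝒱 i) :
    koszul 𝒱 q x = (-1 : ℤˣ) ^ (i * q) • x := by
  simp only [koszul, LinearMap.sum_apply, LinearMap.smul_apply, proj_of_mem 𝒱 hx]
  rw [Finset.sum_eq_single i]
  · simp
  · intro b _ hb; simp [hb]
  · simp

instance parityRevDecomposition : DirectSum.Decomposition (parityRev 𝒱) :=
  DirectSum.IsInternal.chooseDecomposition _ (by
    have h := DirectSum.Decomposition.isInternal 𝒱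
    rw [DirectSum.isInternal_submodule_iff_iSupIndep_and_iSup_eq_top] at h ⊢
    refine ⟨h.1.comp (f := fun i : ZMod 2 => i + 1) (add_left_injective 1), ?_⟩
    rw [← h.2]
    exact (Equiv.addRight (1 : ZMod 2)).iSup_comp (g := 𝒱))

end Graded

/-! ### The graded symmetric coalgebra -/

section Symmetric

variable {k W : Type*} [Field k] [AddCommGroup W] [Module k W]
variable (𝒲 : ZMod 2 → Submodule k W)

/-- The relations `u ⊗ v = (-1)^{|u||v|} v ⊗ u` of the graded symmetric algebra. -/
inductive SymRel : TensorAlgebra k W → TensorAlgebra k W → Prop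
  | comm {i j : ZMod 2} {u v : W} (hu : u ∈ 𝒲 i) (hv : v ∈ 𝒲 j) :
      SymRel (TensorAlgebra.ι k u * TensorAlgebra.ι k v)
        ((-1 : ℤˣ) ^ (i * j) • (TensorAlgebra.ι k v * TensorAlgebra.ι k u))

/-- The graded symmetric algebra of the super vector space `W`, with its unit. -/
def GradedSym : Type _ := RingQuot (SymRel 𝒲)

namespace GradedSym

instance : Ring (GradedSym 𝒲) := inferInstanceAs (Ring (RingQuot (SymRel 𝒲)))

instance : Algebra k (GradedSym 𝒲) := inferInstanceAs (Algebra k (RingQuot (SymRel 𝒲)))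

/-- The quotient map from the tensor algebra. -/
def mk : TensorAlgebra k W →ₐ[k] GradedSym 𝒲 := RingQuot.mkAlgHom k (SymRel 𝒲)

/-- The inclusion of `W` into its graded symmetric algebra. -/
def ι : W →ₗ[k] GradedSym 𝒲 :=
  (mk 𝒲).toLinearMap ∘ₗ TensorAlgebra.ι k

variable {𝒲} in
theorem ι_mul_ι {i j : ZMod 2} {u v : W} (hu : u ∈ 𝒲 i) (hv : v ∈ 𝒲 j) :
    ι 𝒲 u * ι 𝒲 v = (-1 : ℤˣ) ^ (i * j) • (ι 𝒲 v * ι 𝒲 u) := by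
  have h : mk 𝒲 _ = mk 𝒲 _ := RingQuot.mkAlgHom_rel k (SymRel.comm hu hv)
  rw [map_mul, Units.smul_def, map_zsmul, map_mul] at h
  exact h

/-- The universal property of the graded symmetric algebra. -/
def lift {A : Type*} [Ring A] [Algebra k A] (f : W →ₗ[k] A)
    (hf : ∀ (i j : ZMod 2) (u v : W), u ∈ 𝒲 i → v ∈ 𝒲 j →
      f u * f v = (-1 : ℤˣ) ^ (i * j) • (f v * f u)) : GradedSym 𝒲 →ₐ[k] A :=
  RingQuot.liftAlgHom k ⟨TensorAlgebra.lift k f, by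
    rintro _ _ ⟨hu, hv⟩
    rw [map_mul, Units.smul_def, map_zsmul, map_mul]
    simpa [Units.smul_def] using hf _ _ _ _ hu hv⟩

theorem lift_ι {A : Type*} [Ring A] [Algebra k A] (f : W →ₗ[k] A)
    (hf : ∀ (i j : ZMod 2) (u v : W), u ∈ 𝒲 i → v ∈ 𝒲 j →
      f u * f v = (-1 : ℤˣ) ^ (i * j) • (f v * f u)) (w : W) :
    lift 𝒲 f hf (ι 𝒲 w) = f w := by
  have h := RingQuot.liftAlgHom_mkAlgHom_apply k (s := SymRel 𝒲) (TensorAlgebra.lift k f) (by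
    rintro _ _ ⟨hu, hv⟩
    rw [map_mul, Units.smul_def, map_zsmul, map_mul]
    simpa [Units.smul_def] using hf _ _ _ _ hu hv) (TensorAlgebra.ι k w)
  rw [TensorAlgebra.lift_ι_apply] at h
  exact h

theorem algHom_ext {A : Type*} [Ring A] [Algebra k A] {f g : GradedSym 𝒲 →ₐ[k] A}
    (h : ∀ w, f (ι 𝒲 w) = g (ι 𝒲 w)) : f = g := by
  refine RingQuot.ringQuot_ext' k f g (TensorAlgebra.hom_ext ?_)
  ext w
  exact h w

/-- The projection of the symmetric algebra onto its component `W` of degree one: `w ∈ W` acts on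
`k × W` by `(a, m) ↦ (0, a w)`, so that `1 ↦ (1, 0)`, `w ↦ (0, w)` and products of two or more
elements of `W` go to zero when applied to `(1, 0)`. -/
def toBase : GradedSym 𝒲 →ₗ[k] W :=
  LinearMap.snd k k W ∘ₗ LinearMap.applyₗ ((1, 0) : k × W) ∘ₗ
    (lift 𝒲 (A := Module.End k (k × W))
      ((LinearMap.llcomp k (k × W) W (k × W) (LinearMap.inr k k W)) ∘ₗ
        (LinearMap.smulRightₗ (LinearMap.fst k k W))) (by
      intro i j u v _ _
      ext <;> simp)).toLinearMap

theorem toBase_one : toBase 𝒲 1 = 0 := by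
  simp [toBase]

theorem toBase_ι (w : W) : toBase 𝒲 (ι 𝒲 w) = w := by
  simp [toBase, lift_ι]

theorem toBase_ι_mul_ι (u v : W) : toBase 𝒲 (ι 𝒲 u * ι 𝒲 v) = 0 := by
  simp [toBase, lift_ι]

variable [DirectSum.Decomposition 𝒲]

/-- The parity involution: the algebra automorphism with `w ↦ (-1)^{|w|} w` for `w ∈ W`. -/
def invol : GradedSym 𝒲 →ₐ[k] GradedSym 𝒲 :=
  lift 𝒲 (ι 𝒲 ∘ₗ koszul 𝒲 1) (by
    intro i j u v hu hv
    simp only [LinearMap.comp_apply, koszul_of_mem 𝒲 1 hu, koszul_of_mem 𝒲 1 hv,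
      Units.smul_def, map_zsmul, smul_mul_assoc, mul_smul_comm]
    rw [ι_mul_ι hu hv, Units.smul_def]
    simp only [smul_smul]
    congr 1
    ring)

theorem invol_ι {i : ZMod 2} {w : W} (hw : w ∈ 𝒲 i) :
    invol 𝒲 (ι 𝒲 w) = (-1 : ℤˣ) ^ i • ι 𝒲 w := by
  rw [invol, lift_ι, LinearMap.comp_apply, koszul_of_mem 𝒲 1 hw, Units.smul_def, map_zsmul,
    mul_one, Units.smul_def]

theorem invol_invol (x : GradedSym 𝒲) : invol 𝒲 (invol 𝒲 x) = x := by
  have : (invol 𝒲).comp (invol 𝒲) = AlgHom.id k _ := by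
    apply algHom_ext
    intro w
    simp only [AlgHom.comp_apply, AlgHom.id_apply]
    induction w using DirectSum.Decomposition.inductionOn 𝒲 with
    | zero => simp
    | @homogeneous i m =>
      rw [invol_ι 𝒲 m.2, Units.smul_def, map_zsmul, invol_ι 𝒲 m.2, Units.smul_def, smul_smul,
        Int.units_coe_mul_self, one_smul]
    | add m m' h h' => simp only [map_add, h, h']
  exact DFunLike.congr_fun this x

/-- The elements of parity `i` of the symmetric algebra. A product `w₁ ⋯ wₙ` of homogeneous
elements of `W` has parity `|w₁| + ⋯ + |wₙ|`. -/
def parity (i : ZMod 2) : Submodule k (GradedSym 𝒲) :=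
  LinearMap.eqLocus (invol 𝒲).toLinearMap ((-1 : ℤˣ) ^ i • LinearMap.id)

theorem mem_parity {i : ZMod 2} {x : GradedSym 𝒲} :
    x ∈ parity 𝒲 i ↔ invol 𝒲 x = (-1 : ℤˣ) ^ i • x := Iff.rfl

theorem ι_mem_parity {i : ZMod 2} {w : W} (hw : w ∈ 𝒲 i) : ι 𝒲 w ∈ parity 𝒲 i :=
  invol_ι 𝒲 hw

instance : SetLike.GradedMonoid (parity 𝒲) where
  one_mem := by rw [mem_parity]; simp
  mul_mem i j x y hx hy := by
    rw [mem_parity] at hx hy ⊢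
    rw [map_mul, hx, hy, uzpow_add]
    simp only [Units.smul_def, smul_mul_assoc, mul_smul_comm, smul_smul, Units.val_mul]
    rw [mul_comm]

theorem half_mem (i : ZMod 2) (x : GradedSym 𝒲) :
    (2⁻¹ : k) • (x + (-1 : ℤˣ) ^ i • invol 𝒲 x) ∈ parity 𝒲 i := by
  rw [mem_parity, Units.smul_def, Units.smul_def, map_smul, map_add, map_zsmul, invol_invol,
    smul_comm _ (2⁻¹ : k), smul_add _ x, smul_smul, Int.units_coe_mul_self, one_smul, add_comm]

variable [CharZero k]

theorem eq_zero_of_mem_parity {i : ZMod 2} {x : GradedSym 𝒲} (hx : x ∈ parity 𝒲 i)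
    (hx' : x ∈ parity 𝒲 (i + 1)) : x = 0 := by
  rw [mem_parity] at hx hx'
  rw [hx, uzpow_add, uzpow_one, mul_neg_one, Units.neg_smul, eq_neg_iff_add_eq_zero] at hx'
  have h2 : x + x = 0 := by
    have := congrArg (fun z => (-1 : ℤˣ) ^ i • z) hx'
    simpa [smul_add, smul_smul] using this
  have h3 : (2 : k) • x = 0 := by rw [two_smul]; exact h2
  exact (smul_eq_zero.mp h3).resolve_left two_ne_zero

instance gradedAlgebra : GradedAlgebra (parity 𝒲) where
  toDecomposition := DirectSum.IsInternal.chooseDecomposition _ (by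
    rw [DirectSum.isInternal_submodule_iff_isCompl (parity 𝒲) (i := 0) (j := 1) (by decide)
      (by
        ext i
        have : i = 0 ∨ i = 1 := by revert i; decide
        simpa using this)]
    constructor
    · rw [Submodule.disjoint_def]
      intro x h0 h1
      exact eq_zero_of_mem_parity 𝒲 h0 (by simpa using h1)
    · rw [codisjoint_iff, eq_top_iff]
      intro x _
      have := Submodule.add_mem_sup (half_mem 𝒲 0 x) (half_mem 𝒲 1 x)
      convert this using 1
      rw [← smul_add]
      simp only [uzpow_zero, uzpow_one, one_smul, Units.neg_smul]
      rw [add_add_add_comm, add_neg_cancel, add_zero, ← two_smul k x, smul_smul,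
        inv_mul_cancel₀ two_ne_zero, one_smul])

/-- The comultiplication of the graded symmetric coalgebra as a morphism of superalgebras; it is
determined by `w ↦ w ⊗ 1 + 1 ⊗ w` on `W`. -/
def comulAlg : GradedSym 𝒲 →ₐ[k] parity 𝒲 ᵍ⊗[k] parity 𝒲 :=
  lift 𝒲 ((GradedTensorProduct.includeLeft (parity 𝒲) (parity 𝒲)).toLinearMap ∘ₗ ι 𝒲 +
      (GradedTensorProduct.includeRight (parity 𝒲) (parity 𝒲)).toLinearMap ∘ₗ ι 𝒲) (by
    intro i j u v hu hv
    have key : ∀ (a b : ZMod 2) (x y : W), x ∈ 𝒲 a → y ∈ 𝒲 b →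
        (1 : GradedSym 𝒲) ᵍ⊗ₜ[k] (ι 𝒲 x) * ((ι 𝒲 y) ᵍ⊗ₜ[k] (1 : GradedSym 𝒲)) =
          (-1 : ℤˣ) ^ (a * b) • ((ι 𝒲 y) ᵍ⊗ₜ[k] (ι 𝒲 x) : parity 𝒲 ᵍ⊗[k] parity 𝒲) := by
      intro a b x y hx hy
      have := GradedTensorProduct.tmul_coe_mul_coe_tmul (R := k) (parity 𝒲) (parity 𝒲) 1
        ⟨ι 𝒲 x, ι_mem_parity 𝒲 hx⟩ ⟨ι 𝒲 y, ι_mem_parity 𝒲 hy⟩ 1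
      simpa using this
    have keyr : ∀ (x y : W),
        ((ι 𝒲 x) ᵍ⊗ₜ[k] (1 : GradedSym 𝒲)) * ((1 : GradedSym 𝒲) ᵍ⊗ₜ[k] (ι 𝒲 y)) =
          ((ι 𝒲 x) ᵍ⊗ₜ[k] (ι 𝒲 y) : parity 𝒲 ᵍ⊗[k] parity 𝒲) := by
      intro x y
      have := GradedTensorProduct.tmul_one_mul_one_tmul (R := k) (parity 𝒲) (parity 𝒲)
        (ι 𝒲 x) (ι 𝒲 y)
      simpa using this
    have hl : (GradedTensorProduct.includeLeft (R := k) (parity 𝒲) (parity 𝒲)) (ι 𝒲 u) *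
        (GradedTensorProduct.includeLeft (R := k) (parity 𝒲) (parity 𝒲)) (ι 𝒲 v) =
        (-1 : ℤˣ) ^ (i * j) • ((GradedTensorProduct.includeLeft (R := k) (parity 𝒲) (parity 𝒲))
          (ι 𝒲 v) * (GradedTensorProduct.includeLeft (R := k) (parity 𝒲) (parity 𝒲)) (ι 𝒲 u)) := by
      rw [← map_mul, ι_mul_ι hu hv, Units.smul_def, map_zsmul, map_mul, Units.smul_def]
    have hr : (GradedTensorProduct.includeRight (R := k) (parity 𝒲) (parity 𝒲)) (ι 𝒲 u) *
        (GradedTensorProduct.includeRight (R := k) (parity 𝒲) (parity 𝒲)) (ι 𝒲 v) =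
        (-1 : ℤˣ) ^ (i * j) • ((GradedTensorProduct.includeRight (R := k) (parity 𝒲) (parity 𝒲))
          (ι 𝒲 v) *
          (GradedTensorProduct.includeRight (R := k) (parity 𝒲) (parity 𝒲)) (ι 𝒲 u)) := by
      rw [← map_mul, ι_mul_ι hu hv, Units.smul_def, map_zsmul, map_mul, Units.smul_def]
    simp only [LinearMap.add_apply, LinearMap.comp_apply, AlgHom.toLinearMap_apply, add_mul,
      mul_add, smul_add, hl, hr]
    simp only [GradedTensorProduct.includeLeft_apply, GradedTensorProduct.includeRight_apply,
      keyr, key i j u v hu hv, key j i v u hv hu, smul_smul]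
    rw [mul_comm j i, Int.units_mul_self, one_smul]
    abel)

theorem comulAlg_ι (w : W) :
    comulAlg 𝒲 (ι 𝒲 w) = (ι 𝒲 w) ᵍ⊗ₜ[k] (1 : GradedSym 𝒲) + (1 : GradedSym 𝒲) ᵍ⊗ₜ[k] (ι 𝒲 w) := by
  rw [comulAlg, lift_ι]
  simp

/-- The comultiplication `Δ` of the graded symmetric coalgebra, with counit. The coalgebra without
counit is obtained from it by leaving out the unit `1` and the terms `x ⊗ 1` and `1 ⊗ x`. -/
def comul : GradedSym 𝒲 →ₗ[k] GradedSym 𝒲 ⊗[k] GradedSym 𝒲 :=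
  (GradedTensorProduct.of k (parity 𝒲) (parity 𝒲)).symm.toLinearMap ∘ₗ
    (comulAlg 𝒲).toLinearMap

end GradedSym

variable [DirectSum.Decomposition 𝒲] [CharZero k]

/-- Coderivations of parity `q` of the graded symmetric coalgebra: `Δ D = (D ⊗ 1 + 1 ⊗ D) Δ`, where
`(1 ⊗ D) (x ⊗ y) = (-1)^{q|x|} x ⊗ D y`. The coderivations of the coalgebra without counit are those
with `D 1 = 0`. -/
structure IsCoderivation (q : ZMod 2) (D : GradedSym 𝒲 →ₗ[k] GradedSym 𝒲) : Prop where
  map_parity : ∀ (i : ZMod 2) (x : GradedSym 𝒲), x ∈ GradedSym.parity 𝒲 i → D x ∈ GradedSym.parity 𝒲 (i + q)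
  map_one : D 1 = 0
  comul_comp : GradedSym.comul 𝒲 ∘ₗ D =
    (TensorProduct.map D LinearMap.id + TensorProduct.map (koszul (GradedSym.parity 𝒲) q) D) ∘ₗ
      GradedSym.comul 𝒲

end Symmetric

/-! ### Cochains and the Lie algebra coboundary -/

section Cochains

variable {k V : Type*} [Field k] [AddCommGroup V] [Module k V]

/-- The sign `ε(σ; v₁, …, vₙ)`, for homogeneous `vᵢ` of parity `aᵢ`, with
`v₁ ⊙ ⋯ ⊙ vₙ = ε(σ; v) v_{σ(1)} ⊙ ⋯ ⊙ v_{σ(n)}`. -/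
def koszulSign {n : ℕ} (σ : Equiv.Perm (Fin n)) (a : Fin n → ZMod 2) : ℤˣ :=
  ∏ i, ∏ j, if i < j ∧ σ j < σ i then (-1 : ℤˣ) ^ (a (σ i) * a (σ j)) else 1

/-- The unshuffles of type `(p, n - p)`: the permutations of `n` letters that are increasing on the
first `p` letters and on the last `n - p` letters. -/
def unshuffles (p n : ℕ) : Finset (Equiv.Perm (Fin n)) :=
  open scoped Classical in
  Finset.univ.filter fun σ => ∀ i j : Fin n, i < j → (j.val < p ∨ p ≤ i.val) → σ i < σ j

/-- Families `(φ₁, φ₂, …)` of multilinear maps, `φₙ` in `n` variables; `φₙ₊₁` has index `n`. -/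
abbrev Family (k V : Type*) [Field k] [AddCommGroup V] [Module k V] : Type _ :=
  ∀ n : ℕ, MultilinearMap k (fun _ : Fin (n + 1) => V) V

/-- `(v₁, …, vₘ₊₂) ↦ φ(l(v₁, v₂), v₃, …, vₘ₊₂)`. -/
def compInner (l : V →ₗ[k] V →ₗ[k] V) {m : ℕ} (φ : MultilinearMap k (fun _ : Fin (m + 1) => V) V) :
    MultilinearMap k (fun _ : Fin (m + 2) => V) V :=
  LinearMap.uncurryLeft (M := fun _ : Fin (m + 2) => V)
    ((multilinearCurryLeftEquiv k (fun _ : Fin (m + 1) => V) V).symm.toLinearMap ∘ₗ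
      l.compr₂ φ.curryLeft)

/-- `(v₁, …, vₘ₊₂) ↦ l(φ(v₁, …, vₘ₊₁), vₘ₊₂)`. -/
def compOuter (l : V →ₗ[k] V →ₗ[k] V) {m : ℕ} (φ : MultilinearMap k (fun _ : Fin (m + 1) => V) V) :
    MultilinearMap k (fun _ : Fin (m + 2) => V) V :=
  MultilinearMap.uncurryRight (M := fun _ : Fin (m + 2) => V) (l.compMultilinearMap φ)

theorem compInner_apply (l : V →ₗ[k] V →ₗ[k] V) {m : ℕ}
    (φ : MultilinearMap k (fun _ : Fin (m + 1) => V) V) (v : Fin (m + 2) → V) :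
    compInner l φ v = φ (Fin.cons (l (v 0) (v 1)) fun i : Fin m => v i.succ.succ) := by
  rfl

theorem compOuter_apply (l : V →ₗ[k] V →ₗ[k] V) {m : ℕ}
    (φ : MultilinearMap k (fun _ : Fin (m + 1) => V) V) (v : Fin (m + 2) → V) :
    compOuter l φ v = l (φ fun i => v i.castSucc) (v (Fin.last (m + 1))) := by
  rfl

variable (𝒱 : ZMod 2 → Submodule k V) [DirectSum.Decomposition 𝒱]

/-- The multilinear map that agrees with `F a` on homogeneous arguments of parities `a`. -/
def glue {n : ℕ} (F : (Fin n → ZMod 2) → MultilinearMap k (fun _ : Fin n => V) V) :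
    MultilinearMap k (fun _ : Fin n => V) V :=
  ∑ a : Fin n → ZMod 2, (F a).compLinearMap fun i => proj 𝒱 (a i)

theorem glue_apply {n : ℕ} (F : (Fin n → ZMod 2) → MultilinearMap k (fun _ : Fin n => V) V)
    {a : Fin n → ZMod 2} {v : Fin n → V} (hv : ∀ i, v i ∈ 𝒱 (a i)) : glue 𝒱 F v = F a v := by
  rw [glue, _root_.sum_apply, Finset.sum_eq_single a]
  · simp [proj_of_mem 𝒱 (hv _)]
  · intro b _ hb
    obtain ⟨i, hi⟩ := Function.ne_iff.mp hb
    rw [MultilinearMap.compLinearMap_apply]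
    exact (F b).map_coord_zero i (by simp [proj_of_mem 𝒱 (hv i), hi])
  · simp

/-- The space `C^{n+1}(V)` of graded antisymmetric maps in `n + 1` variables with values in `V`: its
elements of parity `r`. -/
def altMaps (n : ℕ) (r : ZMod 2) : Submodule k (MultilinearMap k (fun _ : Fin (n + 1) => V) V) where
  carrier := {f | ∀ (a : Fin (n + 1) → ZMod 2) (v : Fin (n + 1) → V), (∀ i, v i ∈ 𝒱 (a i)) →
    f v ∈ 𝒱 (r + ∑ i, a i) ∧ ∀ σ : Equiv.Perm (Fin (n + 1)),
      f v = (Equiv.Perm.sign σ * koszulSign σ a) • f fun i => v (σ i)}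
  add_mem' := by
    intro f g hf hg a v hv
    refine ⟨add_mem (hf a v hv).1 (hg a v hv).1, fun σ => ?_⟩
    rw [_root_.add_apply, _root_.add_apply, smul_add, ← (hf a v hv).2 σ,
      ← (hg a v hv).2 σ]
  zero_mem' := by
    intro a v hv
    exact ⟨zero_mem _, fun σ => by simp⟩
  smul_mem' := by
    intro c f hf a v hv
    refine ⟨Submodule.smul_mem _ c (hf a v hv).1, fun σ => ?_⟩
    rw [_root_.smul_apply, _root_.smul_apply, smul_comm, ← (hf a v hv).2 σ]

/-- The part `C(V)_q` of total parity `q` of `C(V) = Hom(⋀ V, V) = ∏_{n ≥ 1} Hom(⋀ⁿ V, V)`: the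
component `φₙ` has parity `q + (n - 1)`, so that the corresponding map `⨀ⁿ ΠV → ΠV` has parity
`q`. -/
def cochains (q : ZMod 2) : Submodule k (Family k V) :=
  Submodule.pi Set.univ fun n => altMaps 𝒱 n (q + n)

/-- The axioms of a `ℤ/2`-graded Lie algebra. -/
structure IsLieSuperalgebra (l : V →ₗ[k] V →ₗ[k] V) : Prop where
  even : ∀ (i j : ZMod 2) (x y : V), x ∈ 𝒱 i → y ∈ 𝒱 j → l x y ∈ 𝒱 (i + j)
  skew : ∀ (i j : ZMod 2) (x y : V), x ∈ 𝒱 i → y ∈ 𝒱 j → l x y = -((-1 : ℤˣ) ^ (i * j) • l y x)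
  jacobi : ∀ (i j : ZMod 2) (x y z : V), x ∈ 𝒱 i → y ∈ 𝒱 j →
    l x (l y z) = l (l x y) z + (-1 : ℤˣ) ^ (i * j) • l y (l x z)

/-- The coboundary `dφ` of a multilinear map `φ` in `m + 1` variables for the bracket `l`. -/
def lieCoboundary (l : V →ₗ[k] V →ₗ[k] V) {m : ℕ}
    (φ : MultilinearMap k (fun _ : Fin (m + 1) => V) V) :
    MultilinearMap k (fun _ : Fin (m + 2) => V) V :=
  glue 𝒱 fun a =>
    ∑ σ ∈ unshuffles 2 (m + 2),
        (Equiv.Perm.sign σ * koszulSign σ a) • (compInner l φ).domDomCongr σ -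
      (-1 : ℤˣ) ^ m • ∑ σ ∈ unshuffles (m + 1) (m + 2),
        (Equiv.Perm.sign σ * koszulSign σ a) • (compOuter l φ).domDomCongr σ

theorem lieCoboundary_apply (l : V →ₗ[k] V →ₗ[k] V) {m : ℕ}
    (φ : MultilinearMap k (fun _ : Fin (m + 1) => V) V) {a : Fin (m + 2) → ZMod 2}
    {v : Fin (m + 2) → V} (hv : ∀ i, v i ∈ 𝒱 (a i)) :
    lieCoboundary 𝒱 l φ v =
      ∑ σ ∈ unshuffles 2 (m + 2), (Equiv.Perm.sign σ * koszulSign σ a) •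
        φ (Fin.cons (l (v (σ 0)) (v (σ 1))) fun i : Fin m => v (σ i.succ.succ)) -
      (-1 : ℤˣ) ^ m • ∑ σ ∈ unshuffles (m + 1) (m + 2), (Equiv.Perm.sign σ * koszulSign σ a) •
        l (φ fun i => v (σ i.castSucc)) (v (σ (Fin.last (m + 1)))) := by
  rw [lieCoboundary, glue_apply 𝒱 _ hv]
  simp [compInner_apply, compOuter_apply]

/-- The Lie algebra coboundary operator `d` on families of cochains; `(dφ)₁ = 0`. -/
def lieDiff (l : V →ₗ[k] V →ₗ[k] V) : Family k V →ₗ[k] Family k V where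
  toFun φ
    | 0 => 0
    | m + 1 => lieCoboundary 𝒱 l (φ m)
  map_add' φ ψ := by
    funext n
    cases n with
    | zero => simp
    | succ m =>
      ext v
      simp only [lieCoboundary, glue, Pi.add_apply, _root_.sum_apply,
        _root_.add_apply, MultilinearMap.compLinearMap_apply, _root_.sub_apply,
        _root_.smul_apply, MultilinearMap.domDomCongr_apply, compInner_apply,
        compOuter_apply, map_add, LinearMap.add_apply, smul_add]
      rw [← Finset.sum_add_distrib]
      refine Finset.sum_congr rfl fun a _ => ?_
      simp only [Finset.sum_add_distrib, smul_add]
      abel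
  map_smul' c φ := by
    funext n
    cases n with
    | zero => simp
    | succ m =>
      ext v
      simp only [lieCoboundary, glue, Pi.smul_apply, _root_.sum_apply,
        MultilinearMap.compLinearMap_apply, _root_.sub_apply, RingHom.id_apply,
        _root_.smul_apply, MultilinearMap.domDomCongr_apply, compInner_apply,
        compOuter_apply, map_smul, LinearMap.smul_apply, Finset.smul_sum, smul_sub]
      simp only [smul_comm _ c]

/-- The cocycles of total parity `q`. -/
def lieCocycles (l : V →ₗ[k] V →ₗ[k] V) (q : ZMod 2) : Submodule k (Family k V) :=
  cochains 𝒱 q ⊓ LinearMap.ker (lieDiff 𝒱 l)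

/-- The coboundaries of total parity `q`: the coboundary operator reverses the total parity. -/
def lieCoboundaries (l : V →ₗ[k] V →ₗ[k] V) (q : ZMod 2) : Submodule k (Family k V) :=
  (cochains 𝒱 (q + 1)).map (lieDiff 𝒱 l)

/-- The part of total parity `q` of the Lie algebra cohomology `H(V) = ∏_{n ≥ 1} Hⁿ(V)` with
coefficients in the adjoint representation. -/
abbrev LieCohomology (l : V →ₗ[k] V →ₗ[k] V) (q : ZMod 2) : Type _ :=
  lieCocycles 𝒱 l q ⧸ (lieCoboundaries 𝒱 l q).submoduleOf (lieCocycles 𝒱 l q)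

end Cochains

/-! ### L∞ algebras -/

section LInfinity

variable {k V : Type*} [Field k] [AddCommGroup V] [Module k V]
variable (𝒱 : ZMod 2 → Submodule k V) [DirectSum.Decomposition 𝒱]

/-- The graded symmetric algebra of the parity reversion of `V`. -/
abbrev SymRev : Type _ := GradedSym (parityRev 𝒱)

/-- The sign `(-1)^{(n-1) a₁ + (n-2) a₂ + ⋯ + aₙ₋₁}` of the isomorphism
`v₁ ∧ ⋯ ∧ vₙ ↦ ± π v₁ ⊙ ⋯ ⊙ π vₙ` between `⋀ⁿ V` and `⨀ⁿ ΠV`. -/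
def etaSign {n : ℕ} (a : Fin n → ZMod 2) : ℤˣ :=
  (-1 : ℤˣ) ^ (∑ i : Fin n, ((n - 1 - i.val : ℕ) : ZMod 2) * a i)

/-- The family `φₙ = η₁⁻¹ ∘ δₙ ∘ ηₙ` of maps `⋀ⁿ V → V` determined by a linear endomorphism `δ` of the
symmetric coalgebra of `ΠV`, where `δₙ : ⨀ⁿ ΠV → ΠV` is induced by `δ`. -/
def structureMaps (δ : SymRev 𝒱 →ₗ[k] SymRev 𝒱) : Family k V := fun n =>
  glue 𝒱 fun a => etaSign a •
    (GradedSym.toBase (parityRev 𝒱) ∘ₗ δ).compMultilinearMap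
      ((MultilinearMap.mkPiAlgebraFin k (n + 1) (SymRev 𝒱)).compLinearMap
        fun _ => GradedSym.ι (parityRev 𝒱))

theorem structureMaps_apply (δ : SymRev 𝒱 →ₗ[k] SymRev 𝒱) {n : ℕ} {a : Fin (n + 1) → ZMod 2}
    {v : Fin (n + 1) → V} (hv : ∀ i, v i ∈ 𝒱 (a i)) :
    structureMaps 𝒱 δ n v = etaSign a • GradedSym.toBase (parityRev 𝒱)
      (δ (List.ofFn fun i => GradedSym.ι (parityRev 𝒱) (v i)).prod) := by
  rw [structureMaps, glue_apply 𝒱 _ hv]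
  simp

variable [CharZero k]

/-- An `L∞` algebra structure on `V`: an odd codifferential on the symmetric coalgebra of `ΠV`. -/
structure LInfinityStructure where
  /-- the codifferential -/
  d : SymRev 𝒱 →ₗ[k] SymRev 𝒱
  isCoderivation : IsCoderivation (parityRev 𝒱) 1 d
  sq_zero : d ∘ₗ d = 0

variable {𝒱}

/-- The `L∞` structure is the one given by the binary bracket `l`: `l₂ = l` and `lₙ = 0` for
`n ≠ 2`. -/
def LInfinityStructure.IsInducedBy (D : LInfinityStructure 𝒱) (l : V →ₗ[k] V →ₗ[k] V) : Prop :=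
  (∀ v : Fin 2 → V, structureMaps 𝒱 D.d 1 v = l (v 0) (v 1)) ∧
    ∀ n : ℕ, n ≠ 1 → structureMaps 𝒱 D.d n = 0

/-- The `L∞` coboundary `[δ, d] = δ d - (-1)^q d δ` of a coderivation `δ` of parity `q`. -/
def LInfinityStructure.coboundary (D : LInfinityStructure 𝒱) (q : ZMod 2)
    (δ : SymRev 𝒱 →ₗ[k] SymRev 𝒱) : SymRev 𝒱 →ₗ[k] SymRev 𝒱 :=
  δ ∘ₗ D.d - (-1 : ℤˣ) ^ q • (D.d ∘ₗ δ)

end LInfinity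

/-! ### Extension of scalars by an infinitesimal parameter

For a parameter `t` of parity `p` with `t² = 0`, the elements `x + t y` of `M[t] = M ⊕ t M` are
represented by the pairs `(x, y)`. The parameter commutes with elements of `M` in the graded sense,
and so `t y` has parity `p + |y|`. -/

section Parameter

variable {k M : Type*} [Field k] [AddCommGroup M] [Module k M]

/-- Multiplication by `t`. -/
def tMul : M × M →ₗ[k] M × M := LinearMap.inr k M M ∘ₗ LinearMap.fst k M M

/-- The elements of parity `i` of `M[t]`. -/
def tParity (p : ZMod 2) (ℳ : ZMod 2 → Submodule k M) (i : ZMod 2) : Submodule k (M × M) :=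
  (ℳ i).prod (ℳ (i + p))

/-- `F : M[t] → M[t]` is a homomorphism of parity `q` of modules over `k[t]`. -/
structure IsTLinear (p : ZMod 2) (ℳ : ZMod 2 → Submodule k M) (q : ZMod 2)
    (F : M × M →ₗ[k] M × M) : Prop where
  map_parity : ∀ (i : ZMod 2) (z : M × M), z ∈ tParity p ℳ i → F z ∈ tParity p ℳ (i + q)
  map_tMul : ∀ z : M × M, F (tMul (k := k) z) = (-1 : ℤˣ) ^ (p * q) • tMul (k := k) (F z)

variable (p : ZMod 2) (ℳ : ZMod 2 → Submodule k M) [DirectSum.Decomposition ℳ]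

/-- The tensor product over `k[t]` of elements of `M[t]`, with values in `(M ⊗ M)[t]`:
`(x + t y) ⊗ (x' + t y') = x ⊗ x' + t (y ⊗ x' + (-1)^{p|x|} x ⊗ y')`. -/
def tTensor : M × M →ₗ[k] M × M →ₗ[k] (M ⊗[k] M) × (M ⊗[k] M) :=
  LinearMap.mk₂ k (fun z z' => (z.1 ⊗ₜ[k] z'.1, z.2 ⊗ₜ[k] z'.1 + koszul ℳ p z.1 ⊗ₜ[k] z'.2))
    (by
      intro x y z
      ext <;> simp only [Prod.fst_add, Prod.snd_add, map_add, TensorProduct.add_tmul]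
      abel)
    (by intro c x y; ext <;> simp [TensorProduct.smul_tmul'])
    (by
      intro x y z
      ext <;> simp only [Prod.fst_add, Prod.snd_add, TensorProduct.tmul_add]
      abel)
    (by intro c x y; ext <;> simp)

/-- The restriction to `M ⊗ M` of `F ⊗ 1 + 1 ⊗ F`, for `F` of parity `q`. -/
def tDerivation (q : ZMod 2) (F : M × M →ₗ[k] M × M) :
    M ⊗[k] M →ₗ[k] (M ⊗[k] M) × (M ⊗[k] M) :=
  TensorProduct.lift
    ((tTensor p ℳ).compl₁₂ (F ∘ₗ LinearMap.inl k M M) (LinearMap.inl k M M) +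
      (tTensor p ℳ).compl₁₂ (LinearMap.inl k M M ∘ₗ koszul ℳ q) (F ∘ₗ LinearMap.inl k M M))

/-- The restriction to `M ⊗ M` of `F ⊗ F`, for `F` even. -/
def tSquare (F : M × M →ₗ[k] M × M) : M ⊗[k] M →ₗ[k] (M ⊗[k] M) × (M ⊗[k] M) :=
  TensorProduct.lift
    ((tTensor p ℳ).compl₁₂ (F ∘ₗ LinearMap.inl k M M) (F ∘ₗ LinearMap.inl k M M))

end Parameter

/-! ### Infinitesimal deformations -/

section Deformations

variable {k V : Type*} [Field k] [CharZero k] [AddCommGroup V] [Module k V]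
variable {𝒱 : ZMod 2 → Submodule k V} [DirectSum.Decomposition 𝒱]

/-- The comultiplication over `k[t]`. -/
def tComul (𝒱 : ZMod 2 → Submodule k V) [DirectSum.Decomposition 𝒱] :
    SymRev 𝒱 × SymRev 𝒱 →ₗ[k]
      (SymRev 𝒱 ⊗[k] SymRev 𝒱) × (SymRev 𝒱 ⊗[k] SymRev 𝒱) :=
  (GradedSym.comul (parityRev 𝒱)).prodMap (GradedSym.comul (parityRev 𝒱))

/-- An infinitesimal deformation of an `L∞` algebra with a parameter `t` of parity `p`: an odd
codifferential over `k[t]`, where `t² = 0`, of the symmetric coalgebra of `ΠV` extended to `k[t]`,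
which reduces to the given codifferential modulo `t`. Both sides of `comul_comp` are `k[t]`-linear of
parity `1`, so it is enough to have it on `SymRev 𝒱`. -/
structure InfDeformation (D : LInfinityStructure 𝒱) (p : ZMod 2) where
  /-- the deformed codifferential -/
  d : SymRev 𝒱 × SymRev 𝒱 →ₗ[k] SymRev 𝒱 × SymRev 𝒱
  isTLinear : IsTLinear p (GradedSym.parity (parityRev 𝒱)) 1 d
  map_one : d (1, 0) = 0
  comul_comp : ∀ x : SymRev 𝒱, tComul 𝒱 (d (x, 0)) =
    tDerivation p (GradedSym.parity (parityRev 𝒱)) 1 d (GradedSym.comul (parityRev 𝒱) x)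
  sq_zero : d ∘ₗ d = 0
  reduces : ∀ x : SymRev 𝒱, (d (x, 0)).1 = D.d x

/-- The family `φ` for which the deformed structure is `l + t φ`. -/
def InfDeformation.cochain {D : LInfinityStructure 𝒱} {p : ZMod 2} (F : InfDeformation D p) :
    Family k V :=
  structureMaps 𝒱 (LinearMap.snd k _ _ ∘ₗ F.d ∘ₗ LinearMap.inl k _ _)

/-- Two infinitesimal deformations are equivalent if there is an automorphism over `k[t]` of the
extended symmetric coalgebra of `ΠV` that takes one to the other and is the identity modulo `t`.
The automorphisms of the coalgebra without counit correspond to those that fix `1`. -/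
def InfDeformation.Equivalent {D : LInfinityStructure 𝒱} {p : ZMod 2}
    (F F' : InfDeformation D p) : Prop :=
  ∃ ρ : (SymRev 𝒱 × SymRev 𝒱) ≃ₗ[k] (SymRev 𝒱 × SymRev 𝒱),
    IsTLinear p (GradedSym.parity (parityRev 𝒱)) 0 ρ.toLinearMap ∧
    ρ (1, 0) = (1, 0) ∧
    (∀ x : SymRev 𝒱, tComul 𝒱 (ρ (x, 0)) =
      tSquare p (GradedSym.parity (parityRev 𝒱)) ρ.toLinearMap (GradedSym.comul (parityRev 𝒱) x)) ∧
    (∀ x : SymRev 𝒱, (ρ (x, 0)).1 = x) ∧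
    ρ.toLinearMap ∘ₗ F.d = F'.d ∘ₗ ρ.toLinearMap

end Deformations

end SuperLie

end

open SuperLie

/-!
The symmetric coalgebra of `W = ΠV` is cofree: a linear map `f : ⨀W → W` with `f 1 = 0` is the
corestriction of exactly one coderivation, `x ↦ ∑ f(x') x''`. Existence is a computation with
commutators of this coderivation with multiplication by elements of `W`. For uniqueness, let `E` be
the coderivation whose corestriction is the projection `⨀W → W`; it multiplies the elements of
symmetric degree `n` by `n`. If `δ` is a coderivation with zero corestriction, then `E (δ x)` is a
sum of products of an element of `W` with a value of `δ` in smaller degree, and so it vanishes by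
induction; as the characteristic is zero, `δ x = 0`. Since symmetric multilinear maps on `ΠV` become
alternating ones on `V` through the signs `η`, coderivations correspond to cochains.

Expanding the comultiplication of a monomial over unshuffles turns the commutator with the
coderivation `D` of the bracket into the Lie coboundary of the cochain. In particular, the cochain
of `[D, D] = 2 D²` is the coboundary of the bracket, which vanishes by the Jacobi identity.

Over `k[t]` with `t² = 0`, a deformation is `D + t δ`, and it squares to zero exactly when
`[δ, D] = 0`; an automorphism that is the identity modulo `t` is `1 + t β` with `β` a coderivation,
and it takes `D + t δ` to `D + t δ'` exactly when `δ' - δ = [β, D]`.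
-/

noncomputable section

namespace SuperLie

/-! ### Maps of graded modules -/

section HomogeneousMaps

variable {k M N : Type*} [Field k] [AddCommGroup M] [Module k M] [AddCommGroup N] [Module k N]
variable (ℳ : ZMod 2 → Submodule k M)

/-- The linear maps of parity `q` between the modules graded by `ℳ` and `𝒩`. -/
def HasParity (𝒩 : ZMod 2 → Submodule k N) (q : ZMod 2) (f : M →ₗ[k] N) : Prop :=
  ∀ i, ∀ x ∈ ℳ i, f x ∈ 𝒩 (i + q)

variable {ℳ} in
theorem HasParity.comp {P : Type*} [AddCommGroup P] [Module k P] {𝒩 : ZMod 2 → Submodule k N}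
    {𝒬 : ZMod 2 → Submodule k P} {p q : ZMod 2} {g : N →ₗ[k] P} {f : M →ₗ[k] N}
    (hg : HasParity 𝒩 𝒬 p g) (hf : HasParity ℳ 𝒩 q f) : HasParity ℳ 𝒬 (p + q) (g ∘ₗ f) := by
  intro i x hx
  rw [add_comm p, ← add_assoc]
  exact hg _ _ (hf i x hx)

variable [DirectSum.Decomposition ℳ]

theorem proj_mem (i : ZMod 2) (x : M) : proj ℳ i x ∈ ℳ i :=
  SetLike.coe_mem (DirectSum.decompose ℳ x i)

theorem sum_proj (x : M) : ∑ i, proj ℳ i x = x := by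
  induction x using DirectSum.Decomposition.inductionOn ℳ with
  | zero => simp
  | homogeneous m => simp [proj_of_mem ℳ m.2]
  | add x y hx hy => simp only [map_add, Finset.sum_add_distrib, hx, hy]

theorem hom_ext_homogeneous {f g : M →ₗ[k] N} (h : ∀ i, ∀ x ∈ ℳ i, f x = g x) : f = g := by
  ext x
  induction x using DirectSum.Decomposition.inductionOn ℳ with
  | zero => simp
  | homogeneous m => exact h _ m m.2
  | add x y hx hy => rw [map_add, map_add, hx, hy]

theorem tensor_hom_ext_homogeneous {P : Type*} [AddCommGroup P] [Module k P]
    {f g : M ⊗[k] N →ₗ[k] P} (h : ∀ i, ∀ x ∈ ℳ i, ∀ y, f (x ⊗ₜ y) = g (x ⊗ₜ y)) : f = g :=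
  TensorProduct.ext <| hom_ext_homogeneous ℳ fun i x hx => LinearMap.ext (h i x hx)

theorem koszul_zero : koszul ℳ 0 = LinearMap.id :=
  hom_ext_homogeneous ℳ fun i x hx => by simp [koszul_of_mem ℳ 0 hx]

theorem koszul_koszul (p q : ZMod 2) (x : M) : koszul ℳ p (koszul ℳ q x) = koszul ℳ (p + q) x := by
  suffices koszul ℳ p ∘ₗ koszul ℳ q = koszul ℳ (p + q) from LinearMap.congr_fun this x
  refine hom_ext_homogeneous ℳ fun i x hx => ?_
  rw [LinearMap.comp_apply, koszul_of_mem ℳ q hx, LinearMap.map_smul_of_tower,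
    koszul_of_mem ℳ p hx, koszul_of_mem ℳ _ hx, smul_smul, ← uzpow_add, mul_add, add_comm]

variable {ℳ} {𝒩 : ZMod 2 → Submodule k N} [DirectSum.Decomposition 𝒩] {q : ZMod 2} {f : M →ₗ[k] N}

theorem HasParity.koszul_comm (hf : HasParity ℳ 𝒩 q f) (p : ZMod 2) (x : M) :
    koszul 𝒩 p (f x) = (-1 : ℤˣ) ^ (p * q) • f (koszul ℳ p x) := by
  suffices koszul 𝒩 p ∘ₗ f = (-1 : ℤˣ) ^ (p * q) • f ∘ₗ koszul ℳ p from LinearMap.congr_fun this x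
  refine hom_ext_homogeneous ℳ fun i x hx => ?_
  rw [LinearMap.comp_apply, koszul_of_mem 𝒩 p (hf i x hx), LinearMap.smul_apply,
    LinearMap.comp_apply, koszul_of_mem ℳ p hx, LinearMap.map_smul_of_tower, smul_smul,
    ← uzpow_add, add_mul, add_comm, mul_comm q]

variable [CharZero k]

theorem mem_of_koszul_one {i : ZMod 2} {x : M} (h : koszul ℳ 1 x = (-1 : ℤˣ) ^ i • x) :
    x ∈ ℳ i := by
  have hdecomp : x = proj ℳ i x + proj ℳ (i + 1) x := by
    conv_lhs => rw [← sum_proj ℳ x]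
    fin_cases i
    · exact Fin.sum_univ_two _
    · exact (Fin.sum_univ_two _).trans (add_comm _ _)
  rw [hdecomp, map_add, koszul_of_mem ℳ 1 (proj_mem ℳ i x),
    koszul_of_mem ℳ 1 (proj_mem ℳ (i + 1) x), mul_one, mul_one, smul_add, add_right_inj,
    uzpow_add, uzpow_one, mul_neg_one, Units.neg_smul, neg_eq_iff_add_eq_zero, ← two_smul k,
    smul_eq_zero_iff_right two_ne_zero, smul_eq_zero_iff_eq] at h
  rw [hdecomp, h, add_zero]
  exact proj_mem ℳ i x

theorem hasParity_of_koszul_comm (h : ∀ x, koszul 𝒩 1 (f x) = (-1 : ℤˣ) ^ q • f (koszul ℳ 1 x)) :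
    HasParity ℳ 𝒩 q f := by
  intro i x hx
  apply mem_of_koszul_one
  rw [h, koszul_of_mem ℳ 1 hx, LinearMap.map_smul_of_tower, smul_smul, ← uzpow_add, mul_one,
    add_comm]

end HomogeneousMaps

section TensorDerivation

variable {k M N : Type*} [Field k] [AddCommGroup M] [Module k M] [AddCommGroup N] [Module k N]

theorem units_smul_tmul (u : ℤˣ) (x : M) (y : N) : (u • x) ⊗ₜ[k] y = u • (x ⊗ₜ[k] y) :=
  ((TensorProduct.mk k M N).flip y).map_smul_of_tower u x

theorem tmul_units_smul (u : ℤˣ) (x : M) (y : N) : x ⊗ₜ[k] (u • y) = u • (x ⊗ₜ[k] y) :=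
  (TensorProduct.mk k M N x).map_smul_of_tower u y

variable (ℳ : ZMod 2 → Submodule k M) [DirectSum.Decomposition ℳ]

/-- The map `D ⊗ 1 + 1 ⊗ D` on `M ⊗ M` for `D` of parity `q`, where the second summand carries the
sign `(-1)^{q|x|}` of moving `D` past `x` in `x ⊗ y`. -/
def tensorDerivation (q : ZMod 2) (D : M →ₗ[k] M) : M ⊗[k] M →ₗ[k] M ⊗[k] M :=
  TensorProduct.map D LinearMap.id + TensorProduct.map (koszul ℳ q) D

theorem tensorDerivation_tmul (q : ZMod 2) (D : M →ₗ[k] M) (x y : M) :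
    tensorDerivation ℳ q D (x ⊗ₜ y) = D x ⊗ₜ y + koszul ℳ q x ⊗ₜ D y := by
  simp [tensorDerivation]

theorem tensorDerivation_sub (q : ZMod 2) (D D' : M →ₗ[k] M) :
    tensorDerivation ℳ q (D - D') = tensorDerivation ℳ q D - tensorDerivation ℳ q D' := by
  ext x y
  simp only [TensorProduct.AlgebraTensorModule.curry_apply, TensorProduct.curry_apply,
    LinearMap.coe_restrictScalars, LinearMap.sub_apply, tensorDerivation_tmul,
    TensorProduct.sub_tmul, TensorProduct.tmul_sub]
  abel

variable {ℳ}

theorem tensorDerivation_commutator {p q : ZMod 2} {D D' : M →ₗ[k] M} (hD : HasParity ℳ ℳ p D)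
    (hD' : HasParity ℳ ℳ q D') :
    tensorDerivation ℳ (p + q) (D ∘ₗ D' - (-1 : ℤˣ) ^ (p * q) • D' ∘ₗ D) =
      tensorDerivation ℳ p D ∘ₗ tensorDerivation ℳ q D' -
        (-1 : ℤˣ) ^ (p * q) • tensorDerivation ℳ q D' ∘ₗ tensorDerivation ℳ p D := by
  ext x y
  simp only [TensorProduct.AlgebraTensorModule.curry_apply, TensorProduct.curry_apply,
    LinearMap.coe_restrictScalars, LinearMap.sub_apply, LinearMap.smul_apply, LinearMap.comp_apply,
    tensorDerivation_tmul, map_add, hD.koszul_comm, hD'.koszul_comm, koszul_koszul,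
    TensorProduct.sub_tmul, TensorProduct.tmul_sub, units_smul_tmul, tmul_units_smul, smul_add,
    smul_smul, Int.units_mul_self, one_smul, mul_comm q p, add_comm q p]
  abel

end TensorDerivation

/-! ### The graded symmetric bialgebra -/

namespace GradedSym

section Generators

variable {k W : Type*} [Field k] [AddCommGroup W] [Module k W]
variable (𝒲 : ZMod 2 → Submodule k W)

theorem mk_surjective : Function.Surjective (mk 𝒲) := RingQuot.mkAlgHom_surjective k _

variable [DirectSum.Decomposition 𝒲]

@[elab_as_elim]
theorem induction_ι_mul {C : GradedSym 𝒲 → Prop} (one : C 1)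
    (ι_mul : ∀ i, ∀ w ∈ 𝒲 i, ∀ x, C x → C (ι 𝒲 w * x)) (add : ∀ x y, C x → C y → C (x + y))
    (smul : ∀ (c : k) x, C x → C (c • x)) (x : GradedSym 𝒲) : C x := by
  have zero : C 0 := by simpa using smul 0 1 one
  have ι_mul' : ∀ w x, C x → C (ι 𝒲 w * x) := by
    intro w x hx
    induction w using DirectSum.Decomposition.inductionOn 𝒲 with
    | zero => simpa using zero
    | homogeneous m => exact ι_mul _ m m.2 x hx
    | add w w' hw hw' => rw [map_add, add_mul]; exact add _ _ hw hw'
  have mk_mul : ∀ t y, C y → C (mk 𝒲 t * y) := by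
    intro t
    induction t using TensorAlgebra.induction with
    | algebraMap r => intro y hy; rw [AlgHom.commutes, ← Algebra.smul_def]; exact smul r y hy
    | ι w => exact ι_mul' w
    | mul a b ha hb => intro y hy; rw [map_mul, mul_assoc]; exact ha _ (hb _ hy)
    | add a b ha hb => intro y hy; rw [map_add, add_mul]; exact add _ _ (ha _ hy) (hb _ hy)
  obtain ⟨t, rfl⟩ := mk_surjective 𝒲 x
  simpa using mk_mul t 1 one

theorem hom_ext_ι_mul {N : Type*} [AddCommGroup N] [Module k N] {f g : GradedSym 𝒲 →ₗ[k] N}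
    (one : f 1 = g 1)
    (ι_mul : ∀ i, ∀ w ∈ 𝒲 i, ∀ x, f x = g x → f (ι 𝒲 w * x) = g (ι 𝒲 w * x)) : f = g := by
  ext x
  induction x using induction_ι_mul with
  | one => exact one
  | ι_mul i w hw x hx => exact ι_mul i w hw x hx
  | add x y hx hy => rw [map_add, map_add, hx, hy]
  | smul c x hx => rw [map_smul, map_smul, hx]

variable {𝒲} in
theorem hasParity_mulLeft_ι {i : ZMod 2} {w : W} (hw : w ∈ 𝒲 i) :
    HasParity (parity 𝒲) (parity 𝒲) i (LinearMap.mulLeft k (ι 𝒲 w)) := by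
  intro j x hx
  rw [add_comm]
  exact SetLike.mul_mem_graded (ι_mem_parity 𝒲 hw) hx

end Generators

section Counit

variable {k W : Type*} [Field k] [AddCommGroup W] [Module k W]
variable (𝒲 : ZMod 2 → Submodule k W)

/-- The counit of the graded symmetric coalgebra: the projection onto its component of degree zero,
given by the same action on `k × W` as `toBase`. -/
def counit : GradedSym 𝒲 →ₗ[k] k :=
  LinearMap.fst k k W ∘ₗ LinearMap.applyₗ ((1, 0) : k × W) ∘ₗ
    (lift 𝒲 (A := Module.End k (k × W))
      ((LinearMap.llcomp k (k × W) W (k × W) (LinearMap.inr k k W)) ∘ₗ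
        (LinearMap.smulRightₗ (LinearMap.fst k k W))) (by
      intro i j u v _ _
      ext <;> simp)).toLinearMap

theorem counit_one : counit 𝒲 1 = 1 := by simp [counit]

theorem counit_ι_mul (w : W) (x : GradedSym 𝒲) : counit 𝒲 (ι 𝒲 w * x) = 0 := by
  simp [counit, lift_ι]

theorem toBase_ι_mul (w : W) (x : GradedSym 𝒲) : toBase 𝒲 (ι 𝒲 w * x) = counit 𝒲 x • w := by
  simp [toBase, counit, lift_ι]

theorem toBase_comp_mulLeft_ι (w : W) :
    toBase 𝒲 ∘ₗ LinearMap.mulLeft k (ι 𝒲 w) = (counit 𝒲).smulRight w := by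
  ext; simp [toBase_ι_mul]

end Counit

variable {k W : Type*} [Field k] [CharZero k] [AddCommGroup W] [Module k W]
variable (𝒲 : ZMod 2 → Submodule k W) [DirectSum.Decomposition 𝒲]

section Parity

variable {𝒲} in
theorem koszul_ι_mul {i : ZMod 2} {w : W} (hw : w ∈ 𝒲 i) (q : ZMod 2) (x : GradedSym 𝒲) :
    koszul (parity 𝒲) q (ι 𝒲 w * x) = (-1 : ℤˣ) ^ (q * i) • (ι 𝒲 w * koszul (parity 𝒲) q x) :=
  (hasParity_mulLeft_ι hw).koszul_comm q x

theorem koszul_parity_one (q : ZMod 2) : koszul (parity 𝒲) q 1 = 1 := by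
  simp [koszul_of_mem (parity 𝒲) q (SetLike.one_mem_graded (parity 𝒲))]

theorem koszul_ι (q : ZMod 2) (w : W) :
    koszul (parity 𝒲) q (ι 𝒲 w) = ι 𝒲 (koszul 𝒲 q w) := by
  have hι : HasParity 𝒲 (parity 𝒲) 0 (ι 𝒲) := fun i w hw => by
    rw [add_zero]; exact ι_mem_parity 𝒲 hw
  simpa using hι.koszul_comm q w

theorem counit_koszul (q : ZMod 2) (x : GradedSym 𝒲) :
    counit 𝒲 (koszul (parity 𝒲) q x) = counit 𝒲 x := by
  suffices counit 𝒲 ∘ₗ koszul (parity 𝒲) q = counit 𝒲 from LinearMap.congr_fun this x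
  refine hom_ext_ι_mul 𝒲 (by simp [koszul_parity_one]) fun i w hw y _ => ?_
  rw [LinearMap.comp_apply, koszul_ι_mul hw, LinearMap.map_smul_of_tower, counit_ι_mul,
    counit_ι_mul, smul_zero]

theorem koszul_toBase (q : ZMod 2) (x : GradedSym 𝒲) :
    koszul 𝒲 q (toBase 𝒲 x) = toBase 𝒲 (koszul (parity 𝒲) q x) := by
  suffices koszul 𝒲 q ∘ₗ toBase 𝒲 = toBase 𝒲 ∘ₗ koszul (parity 𝒲) q from
    LinearMap.congr_fun this x
  refine hom_ext_ι_mul 𝒲 (by simp [koszul_parity_one, toBase_one]) fun i w hw y _ => ?_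
  rw [LinearMap.comp_apply, LinearMap.comp_apply, koszul_ι_mul hw, LinearMap.map_smul_of_tower,
    toBase_ι_mul, toBase_ι_mul, counit_koszul, map_smul, koszul_of_mem 𝒲 q hw, smul_comm, mul_comm]

theorem hasParity_toBase : HasParity (parity 𝒲) 𝒲 0 (toBase 𝒲) :=
  hasParity_of_koszul_comm fun x => by rw [koszul_toBase, uzpow_zero, one_smul]

variable {𝒲} in
theorem mul_ι {i : ZMod 2} {w : W} (hw : w ∈ 𝒲 i) (x : GradedSym 𝒲) :
    x * ι 𝒲 w = ι 𝒲 w * koszul (parity 𝒲) i x := by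
  suffices LinearMap.mulRight k (ι 𝒲 w) = LinearMap.mulLeft k (ι 𝒲 w) ∘ₗ koszul (parity 𝒲) i from
    LinearMap.congr_fun this x
  refine hom_ext_ι_mul 𝒲 (by simp [koszul_parity_one]) fun j u hu y hy => ?_
  simp only [LinearMap.mulRight_apply, LinearMap.comp_apply, LinearMap.mulLeft_apply] at hy ⊢
  rw [koszul_ι_mul hu, mul_assoc, hy, ← mul_assoc, ι_mul_ι hu hw, mul_smul_comm, smul_mul_assoc,
    mul_assoc, mul_comm i j]

end Parity

section Comultiplication

theorem comul_one : comul 𝒲 1 = 1 ⊗ₜ 1 := by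
  simp only [comul, LinearMap.comp_apply, AlgHom.toLinearMap_apply, map_one]
  rfl

variable {𝒲} in
theorem comul_ι_mul {i : ZMod 2} {w : W} (hw : w ∈ 𝒲 i) (x : GradedSym 𝒲) :
    comul 𝒲 (ι 𝒲 w * x) =
      tensorDerivation (parity 𝒲) i (LinearMap.mulLeft k (ι 𝒲 w)) (comul 𝒲 x) := by
  suffices h : (GradedTensorProduct.of k (parity 𝒲) (parity 𝒲)).symm.toLinearMap ∘ₗ
      LinearMap.mulLeft k (comulAlg 𝒲 (ι 𝒲 w)) ∘ₗ
        (GradedTensorProduct.of k (parity 𝒲) (parity 𝒲)).toLinearMap =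
      tensorDerivation (parity 𝒲) i (LinearMap.mulLeft k (ι 𝒲 w)) by
    rw [← h]
    simp [comul]
  refine tensor_hom_ext_homogeneous (parity 𝒲) fun j y hy z => ?_
  have left_mul := GradedTensorProduct.tmul_one_mul_coe_tmul (R := k) (parity 𝒲) (parity 𝒲)
    (ι 𝒲 w) ⟨y, hy⟩ z
  have right_mul := GradedTensorProduct.tmul_coe_mul_coe_tmul (R := k) (parity 𝒲) (parity 𝒲) 1
    ⟨ι 𝒲 w, ι_mem_parity 𝒲 hw⟩ ⟨y, hy⟩ z
  simp only [one_mul] at left_mul right_mul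
  simp only [LinearMap.comp_apply, LinearMap.mulLeft_apply, comulAlg_ι, add_mul,
    LinearEquiv.coe_coe]
  rw [tensorDerivation_tmul, koszul_of_mem (parity 𝒲) i hy, units_smul_tmul]
  erw [left_mul, right_mul]
  rw [map_add, mul_comm j i]
  rfl

theorem comul_ι (w : W) : comul 𝒲 (ι 𝒲 w) = ι 𝒲 w ⊗ₜ 1 + 1 ⊗ₜ ι 𝒲 w := by
  simp only [comul, LinearMap.comp_apply, AlgHom.toLinearMap_apply, comulAlg_ι, map_add]
  rfl

end Comultiplication

section Convolution

variable {N : Type*} [AddCommGroup N] [Module k N]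

/-- The map `x ↦ ∑ B(x', x'')`, where `Δ x = ∑ x' ⊗ x''`. -/
def conv (B : GradedSym 𝒲 →ₗ[k] GradedSym 𝒲 →ₗ[k] N) : GradedSym 𝒲 →ₗ[k] N :=
  TensorProduct.lift B ∘ₗ comul 𝒲

theorem conv_one (B : GradedSym 𝒲 →ₗ[k] GradedSym 𝒲 →ₗ[k] N) : conv 𝒲 B 1 = B 1 1 := by
  simp [conv, comul_one]

theorem conv_zero : conv 𝒲 (0 : GradedSym 𝒲 →ₗ[k] GradedSym 𝒲 →ₗ[k] N) = 0 := by
  have hlift : TensorProduct.lift (0 : GradedSym 𝒲 →ₗ[k] GradedSym 𝒲 →ₗ[k] N) = 0 := by ext; simp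
  rw [conv, hlift, LinearMap.zero_comp]

theorem conv_compr₂ {P : Type*} [AddCommGroup P] [Module k P]
    (B : GradedSym 𝒲 →ₗ[k] GradedSym 𝒲 →ₗ[k] N) (g : N →ₗ[k] P) :
    conv 𝒲 (B.compr₂ g) = g ∘ₗ conv 𝒲 B := by
  rw [conv, conv, ← LinearMap.comp_assoc]
  congr 1
  ext
  simp

variable {𝒲} in
theorem conv_ι_mul (B : GradedSym 𝒲 →ₗ[k] GradedSym 𝒲 →ₗ[k] N) {i : ZMod 2} {w : W} (hw : w ∈ 𝒲 i)
    (x : GradedSym 𝒲) :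
    conv 𝒲 B (ι 𝒲 w * x) = conv 𝒲 (B ∘ₗ LinearMap.mulLeft k (ι 𝒲 w)) x +
      conv 𝒲 (B.compl₁₂ (koszul (parity 𝒲) i) (LinearMap.mulLeft k (ι 𝒲 w))) x := by
  suffices TensorProduct.lift B ∘ₗ
      tensorDerivation (parity 𝒲) i (LinearMap.mulLeft k (ι 𝒲 w)) =
      TensorProduct.lift (B ∘ₗ LinearMap.mulLeft k (ι 𝒲 w)) + TensorProduct.lift
        (B.compl₁₂ (koszul (parity 𝒲) i) (LinearMap.mulLeft k (ι 𝒲 w))) by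
    rw [conv, LinearMap.comp_apply, comul_ι_mul hw]
    exact LinearMap.congr_fun this (comul 𝒲 x)
  ext y z
  simp [tensorDerivation_tmul]

theorem conv_counit_left (f : GradedSym 𝒲 →ₗ[k] N) : conv 𝒲 ((counit 𝒲).smulRight f) = f := by
  ext x
  induction x using induction_ι_mul generalizing f with
  | one => simp [conv_one, counit_one]
  | ι_mul i w hw x ih =>
    have h₀ : (counit 𝒲).smulRight f ∘ₗ LinearMap.mulLeft k (ι 𝒲 w) = 0 := by
      ext; simp [counit_ι_mul]
    have h₁ : ((counit 𝒲).smulRight f).compl₁₂ (koszul (parity 𝒲) i)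
        (LinearMap.mulLeft k (ι 𝒲 w)) =
        (counit 𝒲).smulRight (f ∘ₗ LinearMap.mulLeft k (ι 𝒲 w)) := by
      ext; simp [counit_koszul]
    rw [conv_ι_mul _ hw, h₀, h₁, conv_zero, ih]
    simp
  | add x y hx hy => simp only [map_add, hx, hy]
  | smul c x hx => simp only [map_smul, hx]

theorem conv_counit_right (f : GradedSym 𝒲 →ₗ[k] N) :
    conv 𝒲 ((counit 𝒲).smulRight f).flip = f := by
  ext x
  induction x using induction_ι_mul generalizing f with
  | one => simp [conv_one, counit_one]
  | ι_mul i w hw x ih =>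
    have h₀ : ((counit 𝒲).smulRight f).flip.compl₁₂ (koszul (parity 𝒲) i)
        (LinearMap.mulLeft k (ι 𝒲 w)) = 0 := by
      ext; simp [counit_ι_mul]
    have h₁ : ((counit 𝒲).smulRight f).flip ∘ₗ LinearMap.mulLeft k (ι 𝒲 w) =
        ((counit 𝒲).smulRight (f ∘ₗ LinearMap.mulLeft k (ι 𝒲 w))).flip := by
      ext; simp
    rw [conv_ι_mul _ hw, h₀, h₁, conv_zero, ih]
    simp
  | add x y hx hy => simp only [map_add, hx, hy]
  | smul c x hx => simp only [map_smul, hx]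

end Convolution

end GradedSym

/-! ### The coderivation with a given corestriction -/

namespace GradedSym

section Coder

variable {k W : Type*} [Field k] [CharZero k] [AddCommGroup W] [Module k W]
variable (𝒲 : ZMod 2 → Submodule k W) [DirectSum.Decomposition 𝒲]

/-- The map `x ↦ ∑ f(x') x''`, where `Δ x = ∑ x' ⊗ x''`: the coderivation of the symmetric
coalgebra with corestriction `f` to `W`. -/
def coder (f : GradedSym 𝒲 →ₗ[k] W) : GradedSym 𝒲 →ₗ[k] GradedSym 𝒲 :=
  conv 𝒲 (LinearMap.mul k (GradedSym 𝒲) ∘ₗ ι 𝒲 ∘ₗ f)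

theorem coder_one (f : GradedSym 𝒲 →ₗ[k] W) : coder 𝒲 f 1 = ι 𝒲 (f 1) := by
  simp [coder, conv_one]

theorem toBase_comp_coder (f : GradedSym 𝒲 →ₗ[k] W) : toBase 𝒲 ∘ₗ coder 𝒲 f = f := by
  have hB : (LinearMap.mul k (GradedSym 𝒲) ∘ₗ ι 𝒲 ∘ₗ f).compr₂ (toBase 𝒲) =
      ((counit 𝒲).smulRight f).flip := by
    ext; simp [toBase_ι_mul]
  rw [coder, ← conv_compr₂, hB, conv_counit_right]

variable {𝒲} {q : ZMod 2} {f : GradedSym 𝒲 →ₗ[k] W} (hf : HasParity (parity 𝒲) 𝒲 q f)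
include hf

theorem ι_mul_ι_koszul {i : ZMod 2} {w : W} (hw : w ∈ 𝒲 i) (x : GradedSym 𝒲) :
    ι 𝒲 (f (koszul (parity 𝒲) i x)) * ι 𝒲 w = (-1 : ℤˣ) ^ (q * i) • (ι 𝒲 w * ι 𝒲 (f x)) := by
  rw [mul_ι hw, koszul_ι, hf.koszul_comm, koszul_koszul, CharTwo.add_self_eq_zero, koszul_zero,
    LinearMap.id_apply, LinearMap.map_smul_of_tower, mul_smul_comm, mul_comm i q]

theorem coder_ι_mul {i : ZMod 2} {w : W} (hw : w ∈ 𝒲 i) (x : GradedSym 𝒲) :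
    coder 𝒲 f (ι 𝒲 w * x) = coder 𝒲 (f ∘ₗ LinearMap.mulLeft k (ι 𝒲 w)) x +
      (-1 : ℤˣ) ^ (q * i) • (ι 𝒲 w * coder 𝒲 f x) := by
  have hB : (LinearMap.mul k (GradedSym 𝒲) ∘ₗ ι 𝒲 ∘ₗ f).compl₁₂ (koszul (parity 𝒲) i)
      (LinearMap.mulLeft k (ι 𝒲 w)) = (LinearMap.mul k (GradedSym 𝒲) ∘ₗ ι 𝒲 ∘ₗ f).compr₂
        ((-1 : ℤˣ) ^ (q * i) • LinearMap.mulLeft k (ι 𝒲 w)) := by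
    ext y z
    simp only [LinearMap.compl₁₂_apply, LinearMap.comp_apply, LinearMap.mulLeft_apply,
      LinearMap.mul_apply', LinearMap.compr₂_apply, LinearMap.smul_apply, ← mul_assoc,
      ι_mul_ι_koszul hf hw, smul_mul_assoc]
  rw [coder, conv_ι_mul _ hw, hB, conv_compr₂]
  rfl

theorem coder_comp_mulLeft_ι {i : ZMod 2} {w : W} (hw : w ∈ 𝒲 i) :
    coder 𝒲 (f ∘ₗ LinearMap.mulLeft k (ι 𝒲 w)) = coder 𝒲 f ∘ₗ LinearMap.mulLeft k (ι 𝒲 w) -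
      (-1 : ℤˣ) ^ (q * i) • LinearMap.mulLeft k (ι 𝒲 w) ∘ₗ coder 𝒲 f := by
  ext x
  exact (sub_eq_of_eq_add (coder_ι_mul hf hw x)).symm

theorem koszul_coder (x : GradedSym 𝒲) :
    koszul (parity 𝒲) 1 (coder 𝒲 f x) = (-1 : ℤˣ) ^ q • coder 𝒲 f (koszul (parity 𝒲) 1 x) := by
  induction x using induction_ι_mul generalizing q f with
  | one =>
    have h1 := hf 0 1 (SetLike.one_mem_graded _)
    rw [koszul_parity_one, coder_one, koszul_ι, koszul_of_mem 𝒲 1 h1, zero_add, mul_one,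
      LinearMap.map_smul_of_tower]
  | ι_mul i w hw x ih =>
    rw [coder_ι_mul hf hw, map_add, ih (hf.comp (hasParity_mulLeft_ι hw)),
      LinearMap.map_smul_of_tower, koszul_ι_mul hw, ih hf, koszul_ι_mul hw,
      LinearMap.map_smul_of_tower, coder_ι_mul hf hw]
    simp only [smul_add, smul_smul, mul_smul_comm, ← uzpow_add, one_mul]
    congr 3
    abel
  | add x y hx hy => simp only [map_add, hx hf, hy hf, smul_add]
  | smul c x hx => simp only [map_smul, hx hf, smul_comm c]

theorem hasParity_coder : HasParity (parity 𝒲) (parity 𝒲) q (coder 𝒲 f) :=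
  hasParity_of_koszul_comm (koszul_coder hf)

/-- Multiplication by `w` and its extension to the tensor square are intertwined by `Δ`, and
`[coder f, w] = coder (f(w ·))`, so the claim for `coder f` follows from that for its commutators
with the elements of `W`. -/
theorem comul_coder (x : GradedSym 𝒲) :
    comul 𝒲 (coder 𝒲 f x) = tensorDerivation (parity 𝒲) q (coder 𝒲 f) (comul 𝒲 x) := by
  induction x using induction_ι_mul generalizing q f with
  | one => simp [coder_one, comul_one, comul_ι, tensorDerivation_tmul, koszul_parity_one]
  | ι_mul i w hw x ih =>
    have hw' := hasParity_mulLeft_ι hw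
    rw [coder_ι_mul hf hw, map_add, ih (hf.comp hw'), coder_comp_mulLeft_ι hf hw,
      tensorDerivation_commutator (hasParity_coder hf) hw', LinearMap.map_smul_of_tower,
      comul_ι_mul hw, ih hf, comul_ι_mul hw]
    simp
  | add x y hx hy => simp only [map_add, hx hf, hy hf]
  | smul c x hx => simp only [map_smul, hx hf]

theorem isCoderivation_coder (h1 : f 1 = 0) : IsCoderivation 𝒲 q (coder 𝒲 f) where
  map_parity := hasParity_coder hf
  map_one := by rw [coder_one, h1, map_zero]
  comul_comp := LinearMap.ext (comul_coder hf)

end Coder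

end GradedSym

/-! ### Koszul signs and monomials -/

section KoszulSigns

variable {n : ℕ}

theorem koszulSign_one (a : Fin n → ZMod 2) : koszulSign 1 a = 1 :=
  Finset.prod_eq_one fun _ _ => Finset.prod_eq_one fun _ _ => if_neg fun h => h.1.asymm h.2

theorem prod_lt_comp_perm {M : Type*} [CommMonoid M] (σ : Equiv.Perm (Fin n))
    {F : Fin n → Fin n → M} (hF : ∀ i j, F i j = F j i) :
    (∏ i, ∏ j, if i < j then F (σ i) (σ j) else 1) = ∏ i, ∏ j, if i < j then F i j else 1 := by
  let sorted (σ : Equiv.Perm (Fin n)) (p : Fin n × Fin n) : Fin n × Fin n :=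
    if σ p.1 < σ p.2 then (σ p.1, σ p.2) else (σ p.2, σ p.1)
  have sorted_lt (σ : Equiv.Perm (Fin n)) : ∀ p, p.1 < p.2 → (sorted σ p).1 < (sorted σ p).2 := by
    intro p hp
    have := σ.injective.ne hp.ne
    grind
  have sorted_sorted (σ : Equiv.Perm (Fin n)) : ∀ p, p.1 < p.2 → sorted σ⁻¹ (sorted σ p) = p := by
    intro p hp
    have inv_apply_self (x) : σ⁻¹ (σ x) = x := σ.symm_apply_apply x
    simp only [sorted]
    grind
  have prod_pairs (G : Fin n → Fin n → M) : (∏ i, ∏ j, if i < j then G i j else 1) =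
      ∏ p : Fin n × Fin n with p.1 < p.2, G p.1 p.2 := by
    rw [Finset.prod_filter, Fintype.prod_prod_type]
  rw [prod_pairs fun i j => F (σ i) (σ j), prod_pairs F]
  refine Finset.prod_nbij' (sorted σ) (sorted σ⁻¹) (by simpa using sorted_lt σ)
    (by simpa using sorted_lt σ⁻¹) (by simpa using sorted_sorted σ)
    (by simpa using sorted_sorted σ⁻¹) fun p _ => ?_
  simp only [sorted]
  split_ifs
  exacts [rfl, hF _ _]

theorem koszulSign_eq_prod_lt (σ : Equiv.Perm (Fin n)) (a : Fin n → ZMod 2) :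
    koszulSign σ a = ∏ i, ∏ j, if i < j then
      (if i < j ↔ σ i < σ j then 1 else (-1 : ℤˣ) ^ (a (σ i) * a (σ j))) else 1 := by
  refine Finset.prod_congr rfl fun i _ => Finset.prod_congr rfl fun j _ => ?_
  have := σ.injective.eq_iff (a := i) (b := j)
  grind

theorem koszulSign_mul (σ τ : Equiv.Perm (Fin n)) (a : Fin n → ZMod 2) :
    koszulSign (σ * τ) a = koszulSign σ a * koszulSign τ (a ∘ σ) := by
  set F : Fin n → Fin n → ℤˣ := fun i j =>
    if i < j ↔ σ i < σ j then 1 else (-1 : ℤˣ) ^ (a (σ i) * a (σ j)) with hF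
  have symm : ∀ i j, F i j = F j i := by
    intro i j
    rcases eq_or_ne i j with rfl | hij
    · rfl
    have h₁ := hij.lt_or_gt
    have h₂ := (σ.injective.ne hij).lt_or_gt
    simp only [hF, mul_comm (a (σ i))]
    grind
  rw [koszulSign_eq_prod_lt σ, ← prod_lt_comp_perm τ symm, koszulSign_eq_prod_lt,
    koszulSign_eq_prod_lt τ]
  simp only [← Finset.prod_mul_distrib, hF, Function.comp_apply, Equiv.Perm.mul_apply]
  refine Finset.prod_congr rfl fun i _ => Finset.prod_congr rfl fun j _ => ?_
  have := Int.units_mul_self ((-1 : ℤˣ) ^ (a (σ (τ i)) * a (σ (τ j))))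
  grind

theorem koszulSign_swap (i : Fin n) (a : Fin (n + 1) → ZMod 2) :
    koszulSign (Equiv.swap i.castSucc i.succ) a = (-1 : ℤˣ) ^ (a i.castSucc * a i.succ) := by
  have inversion_iff : ∀ x y : Fin (n + 1), x < y ∧
      Equiv.swap i.castSucc i.succ y < Equiv.swap i.castSucc i.succ x ↔
      x = i.castSucc ∧ y = i.succ := by
    intro x y
    simp only [Equiv.swap_apply_def]
    grind
  rw [koszulSign, Finset.prod_eq_single i.castSucc, Finset.prod_eq_single i.succ]
  · rw [if_pos ((inversion_iff _ _).mpr ⟨rfl, rfl⟩), Equiv.swap_apply_left, Equiv.swap_apply_right,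
      mul_comm]
  · exact fun y _ hy => if_neg fun h => hy ((inversion_iff _ _).mp h).2
  · simp
  · exact fun x _ hx => Finset.prod_eq_one fun y _ =>
      if_neg fun h => hx ((inversion_iff _ _).mp h).1
  · simp

theorem koszulSign_mul_swap (σ : Equiv.Perm (Fin (n + 1))) (i : Fin n)
    (a : Fin (n + 1) → ZMod 2) :
    koszulSign (σ * Equiv.swap i.castSucc i.succ) a =
      koszulSign σ a * (-1 : ℤˣ) ^ (a (σ i.castSucc) * a (σ i.succ)) := by
  rw [koszulSign_mul, koszulSign_swap]
  rfl

@[elab_as_elim]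
theorem perm_induction_mul_swap {P : Equiv.Perm (Fin (n + 1)) → Prop} (one : P 1)
    (mul_swap : ∀ σ (i : Fin n), P σ → P (σ * Equiv.swap i.castSucc i.succ))
    (σ : Equiv.Perm (Fin (n + 1))) : P σ := by
  have h : σ ∈ Submonoid.closure (Set.range fun i : Fin n => Equiv.swap i.castSucc i.succ) := by
    rw [Equiv.Perm.mclosure_swap_castSucc_succ]
    trivial
  induction h using Submonoid.closure_induction_right with
  | one => exact one
  | mul_right σ _ _ hτ ih =>
    obtain ⟨i, rfl⟩ := hτ
    exact mul_swap σ i ih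

theorem etaSign_swap (i : Fin n) (a : Fin (n + 1) → ZMod 2) :
    etaSign (a ∘ Equiv.swap i.castSucc i.succ) =
      etaSign a * (-1 : ℤˣ) ^ (a i.castSucc + a i.succ) := by
  set τ := Equiv.swap i.castSucc i.succ with hτ
  have weight_swap : ∀ j, ((n - (τ j : ℕ) : ℕ) : ZMod 2) = ((n - (j : ℕ) : ℕ) : ZMod 2) +
      ((if j = i.castSucc then 1 else 0) + if j = i.succ then 1 else 0) := by
    have weight_succ : ((n - (i : ℕ) : ℕ) : ZMod 2) = ((n - (i + 1 : ℕ) : ℕ) : ZMod 2) + 1 := by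
      rw [← Nat.cast_succ]
      congr 1
      omega
    intro j
    rcases eq_or_ne j i.castSucc with rfl | hj
    · simp [hτ, weight_succ, i.castSucc_lt_succ.ne, add_assoc, CharTwo.add_self_eq_zero]
    rcases eq_or_ne j i.succ with rfl | hj'
    · simp [hτ, weight_succ, i.castSucc_lt_succ.ne']
    · simp [hτ, Equiv.swap_apply_of_ne_of_ne hj hj', hj, hj']
  have τ_τ : ∀ j, τ (τ j) = j := Equiv.swap_apply_self _ _
  rw [etaSign, etaSign, ← uzpow_add, ← Equiv.sum_comp τ]
  simp only [Function.comp_apply, τ_τ, Nat.add_sub_cancel, weight_swap]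
  simp [add_mul, Finset.sum_add_distrib]

theorem etaSign_mul_koszulSign (σ : Equiv.Perm (Fin (n + 1))) (a : Fin (n + 1) → ZMod 2) :
    etaSign a * koszulSign σ (fun i => a i + 1) =
      Equiv.Perm.sign σ * koszulSign σ a * etaSign (a ∘ σ) := by
  induction σ using perm_induction_mul_swap with
  | one => simp [koszulSign_one]
  | mul_swap σ i ih =>
    have uzpow_add_one_mul_add_one : ∀ x y : ZMod 2,
        (-1 : ℤˣ) ^ ((x + 1) * (y + 1)) = -((-1 : ℤˣ) ^ (x * y) * (-1 : ℤˣ) ^ (x + y)) := by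
      decide
    rw [koszulSign_mul_swap, koszulSign_mul_swap, Equiv.Perm.sign_mul,
      Equiv.Perm.sign_swap i.castSucc_lt_succ.ne, Equiv.Perm.coe_mul, ← Function.comp_assoc,
      etaSign_swap, ← mul_assoc, ih, uzpow_add_one_mul_add_one]
    apply Units.ext
    push_cast
    simp only [Function.comp_apply]
    ring

end KoszulSigns

namespace GradedSym

section Monomial

variable {k W : Type*} [Field k] [AddCommGroup W] [Module k W]
variable (𝒲 : ZMod 2 → Submodule k W)

/-- The product `w₁ ⋯ wₙ` in the graded symmetric algebra. -/
def monomial {n : ℕ} (w : Fin n → W) : GradedSym 𝒲 := (List.ofFn fun i => ι 𝒲 (w i)).prod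

theorem monomial_zero (w : Fin 0 → W) : monomial 𝒲 w = 1 := by simp [monomial]

theorem monomial_succ {n : ℕ} (w : Fin (n + 1) → W) :
    monomial 𝒲 w = ι 𝒲 (w 0) * monomial 𝒲 (Fin.tail w) := by
  simp [monomial, List.ofFn_succ, Fin.tail]

theorem monomial_cons {n : ℕ} (u : W) (w : Fin n → W) :
    monomial 𝒲 (Fin.cons u w : Fin (n + 1) → W) = ι 𝒲 u * monomial 𝒲 w := by
  rw [monomial_succ, Fin.cons_zero, Fin.tail_cons]

theorem monomial_snoc {n : ℕ} (w : Fin n → W) (u : W) :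
    monomial 𝒲 (Fin.snoc w u : Fin (n + 1) → W) = monomial 𝒲 w * ι 𝒲 u := by
  rw [monomial, List.ofFn_succ', List.concat_eq_append, List.prod_append, List.prod_singleton]
  simp [monomial]

variable {𝒲}

theorem monomial_swap {n : ℕ} (i : Fin n) {b : Fin (n + 1) → ZMod 2} {w : Fin (n + 1) → W}
    (hw : ∀ j, w j ∈ 𝒲 (b j)) :
    monomial 𝒲 w = (-1 : ℤˣ) ^ (b i.castSucc * b i.succ) •
      monomial 𝒲 (w ∘ Equiv.swap i.castSucc i.succ) := by
  induction n with
  | zero => exact i.elim0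
  | succ n ih =>
    rw [monomial_succ, monomial_succ 𝒲 (w ∘ _)]
    cases i using Fin.cases with
    | zero =>
      have swap_tail : Fin.tail (Fin.tail (w ∘ Equiv.swap (Fin.castSucc 0) (Fin.succ 0))) =
          Fin.tail (Fin.tail w) := by
        funext j
        simp only [Fin.tail, Function.comp_apply]
        rw [Equiv.swap_apply_of_ne_of_ne (by simp [Fin.ext_iff]) (by simp [Fin.ext_iff])]
      rw [monomial_succ, monomial_succ 𝒲 (Fin.tail (w ∘ _)), swap_tail, ← mul_assoc, ← mul_assoc,
        Fin.tail, ι_mul_ι (hw 0) (hw (Fin.succ 0)), smul_mul_assoc]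
      simp [Fin.tail]
    | succ i =>
      have swap_tail : Fin.tail (w ∘ Equiv.swap i.succ.castSucc i.succ.succ) =
          Fin.tail w ∘ Equiv.swap i.castSucc i.succ := by
        funext j
        simp only [Fin.tail, Function.comp_apply, ← Fin.succ_castSucc,
          (Fin.succ_injective _).swap_apply]
      rw [ih i (b := Fin.tail b) (w := Fin.tail w) fun j => hw j.succ, swap_tail,
        mul_smul_comm, Function.comp_apply,
        Equiv.swap_apply_of_ne_of_ne (by simp [Fin.ext_iff]) (by simp [Fin.ext_iff])]
      rfl

theorem monomial_perm {n : ℕ} (σ : Equiv.Perm (Fin (n + 1))) {b : Fin (n + 1) → ZMod 2}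
    {w : Fin (n + 1) → W} (hw : ∀ j, w j ∈ 𝒲 (b j)) :
    monomial 𝒲 w = koszulSign σ b • monomial 𝒲 (w ∘ σ) := by
  induction σ using perm_induction_mul_swap with
  | one => simp [koszulSign_one]
  | mul_swap σ i ih =>
    rw [ih, monomial_swap i (b := b ∘ σ) (w := w ∘ σ) fun j => hw (σ j),
      koszulSign_mul_swap, smul_smul]
    rfl

end Monomial

section HomogeneousMonomial

variable {k W : Type*} [Field k] [AddCommGroup W] [Module k W]
variable (𝒲 : ZMod 2 → Submodule k W) [DirectSum.Decomposition 𝒲]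

variable {𝒲} in
theorem monomial_mem_parity {n : ℕ} {b : Fin n → ZMod 2} {w : Fin n → W}
    (hw : ∀ j, w j ∈ 𝒲 (b j)) : monomial 𝒲 w ∈ parity 𝒲 (∑ i, b i) := by
  rw [← List.sum_ofFn]
  exact SetLike.list_prod_ofFn_mem_graded _ _ fun j => ι_mem_parity 𝒲 (hw j)

theorem mem_of_monomial_mem {S : Submodule k (GradedSym 𝒲)}
    (h : ∀ (n : ℕ) (b : Fin n → ZMod 2) (w : Fin n → W), (∀ j, w j ∈ 𝒲 (b j)) → monomial 𝒲 w ∈ S)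
    (x : GradedSym 𝒲) : x ∈ S := by
  induction x using induction_ι_mul generalizing S with
  | one => simpa [monomial_zero] using h 0 Fin.elim0 Fin.elim0 fun j => j.elim0
  | ι_mul i u hu _ ih =>
    refine ih (S := S.comap (LinearMap.mulLeft k (ι 𝒲 u))) fun n b w hw => ?_
    rw [Submodule.mem_comap, LinearMap.mulLeft_apply, ← monomial_cons]
    exact h (n + 1) (Fin.cons i b) _ (Fin.cases hu hw)
  | add _ _ hx hy => exact add_mem (hx h) (hy h)
  | smul c _ hx => exact S.smul_mem c (hx h)

theorem hom_ext_monomial {N : Type*} [AddCommGroup N] [Module k N] {f g : GradedSym 𝒲 →ₗ[k] N}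
    (h : ∀ (n : ℕ) (b : Fin n → ZMod 2) (w : Fin n → W), (∀ j, w j ∈ 𝒲 (b j)) →
      f (monomial 𝒲 w) = g (monomial 𝒲 w)) : f = g :=
  LinearMap.ext <| mem_of_monomial_mem 𝒲 (S := LinearMap.eqLocus f g) h

theorem hasParity_of_monomial [CharZero k] {N : Type*} [AddCommGroup N] [Module k N]
    {𝒩 : ZMod 2 → Submodule k N} [DirectSum.Decomposition 𝒩] {q : ZMod 2} {f : GradedSym 𝒲 →ₗ[k] N}
    (h : ∀ (n : ℕ) (b : Fin n → ZMod 2) (w : Fin n → W), (∀ j, w j ∈ 𝒲 (b j)) →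
      f (monomial 𝒲 w) ∈ 𝒩 (∑ j, b j + q)) : HasParity (parity 𝒲) 𝒩 q f := by
  suffices koszul 𝒩 1 ∘ₗ f = (-1 : ℤˣ) ^ q • f ∘ₗ koszul (parity 𝒲) 1 from
    hasParity_of_koszul_comm (LinearMap.congr_fun this)
  refine hom_ext_monomial 𝒲 fun n b w hw => ?_
  rw [LinearMap.comp_apply, koszul_of_mem 𝒩 1 (h n b w hw), LinearMap.smul_apply,
    LinearMap.comp_apply, koszul_of_mem (parity 𝒲) 1 (monomial_mem_parity hw),
    LinearMap.map_smul_of_tower, smul_smul, ← uzpow_add, mul_one, mul_one, add_comm]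

end HomogeneousMonomial

end GradedSym

/-! ### The comultiplication of a monomial -/

theorem uzpow_sum {ι : Type*} (u : ℤˣ) (s : Finset ι) (f : ι → ZMod 2) :
    u ^ (∑ i ∈ s, f i) = ∏ i ∈ s, u ^ f i :=
  map_sum (AddMonoidHom.mk' (fun x => Additive.ofMul (u ^ x)) (uzpow_add u)) f s

section Unshuffles

variable {n : ℕ}

theorem mem_unshuffles {p : ℕ} {σ : Equiv.Perm (Fin n)} :
    σ ∈ unshuffles p n ↔ ∀ i j : Fin n, i < j → (j.val < p ∨ p ≤ i.val) → σ i < σ j := by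
  simp [unshuffles]

/-- The permutation that takes the value `0` at `i` and whose other values are those of `τ`,
raised by one. -/
def insertZero (i : Fin (n + 1)) (τ : Equiv.Perm (Fin n)) : Equiv.Perm (Fin (n + 1)) :=
  (finSuccEquiv' i).trans ((Equiv.optionCongr τ).trans (finSuccEquiv' 0).symm)

theorem insertZero_self (i : Fin (n + 1)) (τ : Equiv.Perm (Fin n)) : insertZero i τ i = 0 := by
  simp [insertZero]

theorem insertZero_succAbove (i : Fin (n + 1)) (τ : Equiv.Perm (Fin n)) (j : Fin n) :
    insertZero i τ (i.succAbove j) = (τ j).succ := by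
  simp [insertZero]

theorem comp_insertZero_removeNth {α : Type*} (i : Fin (n + 1)) (τ : Equiv.Perm (Fin n))
    (w : Fin (n + 1) → α) : i.removeNth (w ∘ insertZero i τ) = Fin.tail w ∘ τ := by
  funext j
  simp [Fin.removeNth, insertZero_succAbove, Fin.tail]

theorem insertZero_bijective : Function.Bijective
    fun x : Fin (n + 1) × Equiv.Perm (Fin n) => insertZero x.1 x.2 := by
  rw [Fintype.bijective_iff_injective_and_card]
  refine ⟨fun ⟨i, τ⟩ ⟨j, υ⟩ h => ?_, by simp [Fintype.card_perm, Nat.factorial_succ]⟩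
  dsimp only at h
  obtain rfl : i = j := (insertZero j υ).injective <| by
    rw [insertZero_self, ← h, insertZero_self]
  refine Prod.ext rfl (Equiv.ext fun m => Fin.succ_injective _ ?_)
  rw [← insertZero_succAbove i, ← insertZero_succAbove i, h]

theorem insertZero_mem_unshuffles_iff_succAbove {i : Fin (n + 1)} {τ : Equiv.Perm (Fin n)}
    {p : ℕ} :
    insertZero i τ ∈ unshuffles p (n + 1) ↔ (i.val = 0 ∨ i.val = p) ∧ ∀ j j' : Fin n, j < j' →
      ((i.succAbove j').val < p ∨ p ≤ (i.succAbove j).val) → τ j < τ j' := by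
  rw [mem_unshuffles]
  constructor
  · refine fun h => ⟨?_, fun j j' hj hp => ?_⟩
    · by_contra! hi
      have previous_lt : (⟨i - 1, by omega⟩ : Fin (n + 1)) < i :=
        Fin.lt_def.mpr (Nat.sub_one_lt hi.1)
      have := h _ i previous_lt (by simp only; omega)
      simp [insertZero_self] at this
    · simpa [insertZero_succAbove] using h _ _ (Fin.succAbove_lt_succAbove_iff.mpr hj) hp
  · rintro ⟨hi, h⟩ x y hxy hp
    obtain rfl | ⟨j, rfl⟩ := Fin.eq_self_or_eq_succAbove i x
    · obtain rfl | ⟨j', rfl⟩ := Fin.eq_self_or_eq_succAbove x y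
      · exact absurd hxy (lt_irrefl _)
      · simp [insertZero_self, insertZero_succAbove]
    · obtain rfl | ⟨j', rfl⟩ := Fin.eq_self_or_eq_succAbove i y
      · rw [Fin.lt_def] at hxy
        omega
      · rw [insertZero_succAbove, insertZero_succAbove, Fin.succ_lt_succ_iff]
        exact h j j' (Fin.succAbove_lt_succAbove_iff.mp hxy) hp

theorem insertZero_mem_unshuffles {i : Fin (n + 1)} {τ : Equiv.Perm (Fin n)} {p : ℕ} :
    insertZero i τ ∈ unshuffles p (n + 1) ↔
      (i = 0 ∧ ∃ r, p = r + 1 ∧ τ ∈ unshuffles r n) ∨ i.val = p ∧ τ ∈ unshuffles p n := by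
  have succAbove_val (j : Fin n) :
      (i.succAbove j : ℕ) = if j.val < i.val then j.val else j + 1 := by
    simp only [Fin.succAbove, Fin.lt_def, Fin.val_castSucc]
    split_ifs <;> rfl
  rw [insertZero_mem_unshuffles_iff_succAbove]
  simp only [mem_unshuffles]
  constructor
  · rintro ⟨hi, h⟩
    by_cases hp : i.val = p
    · exact Or.inr ⟨hp, by grind⟩
    · exact Or.inl ⟨by grind, p - 1, by grind⟩
  · rintro (⟨rfl, r, rfl, h⟩ | ⟨hp, h⟩)
    · exact ⟨Or.inl rfl, by simpa using h⟩
    · exact ⟨Or.inr hp, by grind⟩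

theorem sum_unshuffles_succ {M : Type*} [AddCommMonoid M]
    (F : ℕ → Equiv.Perm (Fin (n + 1)) → M) :
    ∑ p : Fin (n + 2), ∑ σ ∈ unshuffles p (n + 1), F p σ =
      ∑ p : Fin (n + 1), ∑ τ ∈ unshuffles p n,
        (F (p + 1) (insertZero 0 τ) + F p (insertZero p τ)) := by
  have sum_indicator (m p : ℕ) (G : Equiv.Perm (Fin m) → M) :
      ∑ σ ∈ unshuffles p m, G σ = ∑ σ, if σ ∈ unshuffles p m then G σ else 0 := by
    rw [Finset.sum_ite_mem, Finset.univ_inter]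
  simp only [sum_indicator]
  rw [Finset.sum_comm, ← insertZero_bijective.sum_comp, Fintype.sum_prod_type_right]
  refine Eq.trans (Finset.sum_congr rfl fun τ _ => ?_) Finset.sum_comm
  let first : Fin (n + 2) → M :=
    Fin.cases 0 fun r => if τ ∈ unshuffles r n then F (r + 1) (insertZero 0 τ) else 0
  let second (i : Fin (n + 1)) : M := if τ ∈ unshuffles i n then F i (insertZero i τ) else 0
  have split (i : Fin (n + 1)) (p : Fin (n + 2)) :
      (if insertZero i τ ∈ unshuffles p (n + 1) then F p (insertZero i τ) else 0) =
        (if i = 0 then first p else 0) + if p = i.castSucc then second i else 0 := by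
    have mem_iff := insertZero_mem_unshuffles (i := i) (τ := τ) (p := p)
    cases p using Fin.cases with
    | zero => grind [Fin.val_zero, Fin.castSucc_eq_zero_iff]
    | succ r => grind [Fin.ext_iff, Fin.val_castSucc]
  simp only [split, Finset.sum_add_distrib]
  simp [Fin.sum_univ_succ first, first, second, ← Finset.sum_add_distrib, ite_add_ite]

theorem koszulSign_insertZero (i : Fin (n + 1)) (τ : Equiv.Perm (Fin n))
    (b : Fin (n + 1) → ZMod 2) :
    koszulSign (insertZero i τ) b = koszulSign τ (Fin.tail b) *
      (-1 : ℤˣ) ^ ((∑ j with j.val < i.val, Fin.tail b (τ j)) * b 0) := by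
  have zero_row : (∏ y, if i < y ∧ insertZero i τ y < insertZero i τ i then
      (-1 : ℤˣ) ^ (b (insertZero i τ i) * b (insertZero i τ y)) else 1) = 1 :=
    Finset.prod_eq_one fun y _ => if_neg (by simp [insertZero_self])
  rw [koszulSign, Fin.prod_univ_succAbove _ i, zero_row, one_mul, koszulSign, mul_comm,
    Finset.sum_filter, Finset.sum_mul, uzpow_sum, ← Finset.prod_mul_distrib]
  refine Finset.prod_congr rfl fun j _ => ?_
  rw [Fin.prod_univ_succAbove _ i]
  simp [insertZero_self, insertZero_succAbove, Fin.succAbove_lt_iff_castSucc_lt,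
    Fin.tail, ite_mul]
  rfl

end Unshuffles

namespace GradedSym

section PartialMonomial

variable {k W : Type*} [Field k] [AddCommGroup W] [Module k W]
variable (𝒲 : ZMod 2 → Submodule k W) {n : ℕ}

/-- The product `w₁ ⋯ wₚ` of the first `p` of the vectors `w₁, …, wₙ`. -/
def takeMonomial (p : ℕ) (w : Fin n → W) : GradedSym 𝒲 :=
  ((List.ofFn fun i => ι 𝒲 (w i)).take p).prod

/-- The product `wₚ₊₁ ⋯ wₙ` of all but the first `p` of the vectors `w₁, …, wₙ`. -/
def dropMonomial (p : ℕ) (w : Fin n → W) : GradedSym 𝒲 :=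
  ((List.ofFn fun i => ι 𝒲 (w i)).drop p).prod

theorem takeMonomial_zero (w : Fin n → W) : takeMonomial 𝒲 0 w = 1 := by simp [takeMonomial]

theorem dropMonomial_zero (w : Fin n → W) : dropMonomial 𝒲 0 w = monomial 𝒲 w := rfl

theorem takeMonomial_succ (p : ℕ) (w : Fin (n + 1) → W) :
    takeMonomial 𝒲 (p + 1) w = ι 𝒲 (w 0) * takeMonomial 𝒲 p (Fin.tail w) := by
  simp [takeMonomial, List.ofFn_succ, Fin.tail]

theorem dropMonomial_succ (p : ℕ) (w : Fin (n + 1) → W) :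
    dropMonomial 𝒲 (p + 1) w = dropMonomial 𝒲 p (Fin.tail w) := by
  simp [dropMonomial, List.ofFn_succ, Fin.tail]

theorem takeMonomial_eq_monomial {p : ℕ} (hp : p ≤ n) (w : Fin n → W) :
    takeMonomial 𝒲 p w = monomial 𝒲 (Fin.take p hp w) := by
  rw [takeMonomial, monomial, ← Fin.ofFn_take_eq_take_ofFn hp]
  rfl

theorem dropMonomial_eq_monomial (p : ℕ) (w : Fin n → W) :
    dropMonomial 𝒲 p w = monomial 𝒲 fun i : Fin (n - p) => w ⟨p + i, by omega⟩ := by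
  rw [dropMonomial, monomial]
  congr 1
  exact List.ext_getElem (by simp) (by simp)

theorem takeMonomial_last (w : Fin (n + 1) → W) :
    takeMonomial 𝒲 n w = monomial 𝒲 (Fin.init w) := by
  rw [takeMonomial, List.ofFn_succ', List.concat_eq_append, List.take_left' (by simp), monomial]
  rfl

theorem dropMonomial_last (w : Fin (n + 1) → W) :
    dropMonomial 𝒲 n w = ι 𝒲 (w (Fin.last n)) := by
  rw [dropMonomial, List.ofFn_succ', List.concat_eq_append, List.drop_left' (by simp),
    List.prod_singleton]

theorem tail_removeNth_succ {α : Type*} (w : Fin (n + 2) → α) (p : Fin (n + 1)) :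
    Fin.tail (p.succ.removeNth w) = p.removeNth (Fin.tail w) := by
  funext j
  simp [Fin.tail, Fin.removeNth]

theorem takeMonomial_removeNth (w : Fin (n + 1) → W) (p : Fin (n + 1)) :
    takeMonomial 𝒲 p (p.removeNth w) = takeMonomial 𝒲 p w := by
  induction n with
  | zero => simp [Fin.fin_one_eq_zero, takeMonomial_zero]
  | succ n ih =>
    cases p using Fin.cases with
    | zero => simp [takeMonomial_zero]
    | succ p =>
      rw [Fin.val_succ, takeMonomial_succ, takeMonomial_succ, tail_removeNth_succ, ih]
      rfl

theorem dropMonomial_eq_ι_mul (w : Fin (n + 1) → W) (p : Fin (n + 1)) :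
    dropMonomial 𝒲 p w = ι 𝒲 (w p) * dropMonomial 𝒲 p (p.removeNth w) := by
  induction n with
  | zero =>
    obtain rfl := Fin.fin_one_eq_zero p
    simp [dropMonomial_zero, monomial]
  | succ n ih =>
    cases p using Fin.cases with
    | zero => exact monomial_succ 𝒲 w
    | succ p =>
      rw [Fin.val_succ, dropMonomial_succ, dropMonomial_succ, tail_removeNth_succ, ih]
      rfl

variable {𝒲} in
theorem takeMonomial_mem_parity [DirectSum.Decomposition 𝒲] {b : Fin n → ZMod 2} {w : Fin n → W}
    (hw : ∀ j, w j ∈ 𝒲 (b j)) (p : ℕ) :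
    takeMonomial 𝒲 p w ∈ parity 𝒲 (∑ j with j.val < p, b j) := by
  rw [← List.sum_take_ofFn, takeMonomial, List.ofFn_eq_map, List.ofFn_eq_map, ← List.map_take,
    ← List.map_take]
  exact SetLike.list_prod_map_mem_graded _ _ _ fun j _ => ι_mem_parity 𝒲 (hw j)

end PartialMonomial

section ComulMonomial

variable {k W : Type*} [Field k] [CharZero k] [AddCommGroup W] [Module k W]
variable {𝒲 : ZMod 2 → Submodule k W} [DirectSum.Decomposition 𝒲]
variable {N : Type*} [AddCommGroup N] [Module k N]

theorem conv_monomial (B : GradedSym 𝒲 →ₗ[k] GradedSym 𝒲 →ₗ[k] N) {n : ℕ} {b : Fin n → ZMod 2}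
    {w : Fin n → W} (hw : ∀ j, w j ∈ 𝒲 (b j)) :
    conv 𝒲 B (monomial 𝒲 w) = ∑ p : Fin (n + 1), ∑ σ ∈ unshuffles p n,
      koszulSign σ b • B (takeMonomial 𝒲 p (w ∘ σ)) (dropMonomial 𝒲 p (w ∘ σ)) := by
  induction n generalizing B with
  | zero =>
    have unshuffles_zero : unshuffles 0 0 = {1} := Finset.eq_singleton_iff_unique_mem.mpr
      ⟨mem_unshuffles.mpr fun i => i.elim0, fun _ _ => Subsingleton.elim _ _⟩
    simp [unshuffles_zero, monomial_zero, conv_one, koszulSign_one, takeMonomial_zero,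
      dropMonomial_zero]
  | succ n ih =>
    have tail_mem (j : Fin n) : Fin.tail w j ∈ 𝒲 (Fin.tail b j) := hw j.succ
    rw [monomial_succ, conv_ι_mul B (hw 0), ih _ tail_mem, ih _ tail_mem,
      sum_unshuffles_succ fun p σ =>
        koszulSign σ b • B (takeMonomial 𝒲 p (w ∘ σ)) (dropMonomial 𝒲 p (w ∘ σ))]
    simp only [← Finset.sum_add_distrib]
    refine Finset.sum_congr rfl fun p _ => Finset.sum_congr rfl fun τ _ => ?_
    have tail_comp := comp_insertZero_removeNth 0 τ w
    rw [Fin.removeNth_zero] at tail_comp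
    have take_mem := takeMonomial_mem_parity (b := Fin.tail b ∘ τ) (w := Fin.tail w ∘ τ)
      (fun j => tail_mem (τ j)) p
    rw [takeMonomial_succ, dropMonomial_succ, tail_comp, ← takeMonomial_removeNth,
      dropMonomial_eq_ι_mul, comp_insertZero_removeNth]
    simp [koszulSign_insertZero, insertZero_self, koszul_of_mem _ _ take_mem, smul_smul]

end ComulMonomial

end GradedSym

/-! ### Coderivations are determined by their corestriction -/

section Uniqueness

variable {k W : Type*} [Field k] [CharZero k] [AddCommGroup W] [Module k W]
variable (𝒲 : ZMod 2 → Submodule k W) [DirectSum.Decomposition 𝒲]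

namespace GradedSym

theorem coder_counit_smulRight (w : W) :
    coder 𝒲 ((counit 𝒲).smulRight w) = LinearMap.mulLeft k (ι 𝒲 w) := by
  have hB : LinearMap.mul k (GradedSym 𝒲) ∘ₗ ι 𝒲 ∘ₗ (counit 𝒲).smulRight w =
      (counit 𝒲).smulRight (LinearMap.mulLeft k (ι 𝒲 w)) := by
    ext; simp
  rw [coder, hB, conv_counit_left]

theorem coder_toBase_monomial {n : ℕ} {b : Fin n → ZMod 2} {w : Fin n → W}
    (hw : ∀ j, w j ∈ 𝒲 (b j)) : coder 𝒲 (toBase 𝒲) (monomial 𝒲 w) = (n : k) • monomial 𝒲 w := by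
  induction n with
  | zero => simp [monomial_zero, coder_one, toBase_one]
  | succ n ih =>
    have tail_mem (j : Fin n) : Fin.tail w j ∈ 𝒲 (Fin.tail b j) := hw j.succ
    rw [monomial_succ, coder_ι_mul (hasParity_toBase 𝒲) (hw 0), toBase_comp_mulLeft_ι,
      coder_counit_smulRight, ih tail_mem]
    simp [add_smul, add_comm]

/-- `x ↦ coder toBase x + counit x • 1` multiplies a monomial of length `n` by `max n 1 ≠ 0`, so
that the sum of its eigenspaces for nonzero eigenvalues is everything. -/
theorem eq_zero_of_coder_toBase {y : GradedSym 𝒲} (hy : coder 𝒲 (toBase 𝒲) y = 0)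
    (h1 : counit 𝒲 y = 0) : y = 0 := by
  let E : Module.End k (GradedSym 𝒲) := coder 𝒲 (toBase 𝒲) + (counit 𝒲).smulRight 1
  have mem_eigenspaces (x : GradedSym 𝒲) : x ∈ ⨆ μ, ⨆ _ : μ ≠ (0 : k), E.eigenspace μ := by
    refine mem_of_monomial_mem 𝒲 (fun n b w hw => ?_) x
    refine Submodule.mem_iSup_of_mem ((max n 1 : ℕ) : k) (Submodule.mem_iSup_of_mem ?_ ?_)
    · exact_mod_cast (lt_max_of_lt_right one_pos).ne'
    · rw [Module.End.mem_eigenspace_iff, LinearMap.add_apply, coder_toBase_monomial 𝒲 hw]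
      cases n <;> simp [monomial_zero, monomial_succ, counit_one, counit_ι_mul]
  have mem_ker : y ∈ E.eigenspace 0 := by simp [E, hy, h1]
  exact Submodule.disjoint_def.mp (Module.End.eigenspaces_iSupIndep E 0) y mem_ker
    (mem_eigenspaces y)

variable {N : Type*} [AddCommGroup N] [Module k N]

variable {𝒲}

theorem conv_comp_toBase_ι_mul (B : W →ₗ[k] GradedSym 𝒲 →ₗ[k] N) {i : ZMod 2} {w : W}
    (hw : w ∈ 𝒲 i) (x : GradedSym 𝒲) :
    conv 𝒲 (B ∘ₗ toBase 𝒲) (ι 𝒲 w * x) = B w x +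
      conv 𝒲 (B.compl₁₂ (koszul 𝒲 i) (LinearMap.mulLeft k (ι 𝒲 w)) ∘ₗ toBase 𝒲) x := by
  have first : (B ∘ₗ toBase 𝒲) ∘ₗ LinearMap.mulLeft k (ι 𝒲 w) = (counit 𝒲).smulRight (B w) := by
    ext; simp [toBase_ι_mul]
  have second : (B ∘ₗ toBase 𝒲).compl₁₂ (koszul (parity 𝒲) i) (LinearMap.mulLeft k (ι 𝒲 w)) =
      B.compl₁₂ (koszul 𝒲 i) (LinearMap.mulLeft k (ι 𝒲 w)) ∘ₗ toBase 𝒲 := by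
    ext; simp [koszul_toBase]
  rw [conv_ι_mul _ hw, first, second, conv_counit_left]

theorem conv_comp_toBase_monomial_eq_zero {n : ℕ} (B : W →ₗ[k] GradedSym 𝒲 →ₗ[k] N)
    (hB : ∀ u (b : Fin n → ZMod 2) z, (∀ j, z j ∈ 𝒲 (b j)) → B u (monomial 𝒲 z) = 0)
    {b : Fin (n + 1) → ZMod 2} {w : Fin (n + 1) → W} (hw : ∀ j, w j ∈ 𝒲 (b j)) :
    conv 𝒲 (B ∘ₗ toBase 𝒲) (monomial 𝒲 w) = 0 := by
  have tail_mem (j : Fin n) : Fin.tail w j ∈ 𝒲 (Fin.tail b j) := hw j.succ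
  induction n generalizing B with
  | zero =>
    rw [monomial_succ, conv_comp_toBase_ι_mul B (hw 0), hB _ _ _ tail_mem, monomial_zero, conv_one]
    simp [toBase_one]
  | succ n ih =>
    rw [monomial_succ, conv_comp_toBase_ι_mul B (hw 0), hB _ _ _ tail_mem, zero_add,
      ih _ _ tail_mem fun j => tail_mem j.succ]
    intro u c z hz
    rw [LinearMap.compl₁₂_apply, LinearMap.mulLeft_apply, ← monomial_cons]
    exact hB _ (Fin.cons (b 0) c) _ <| Fin.cases (hw 0) hz

end GradedSym

open GradedSym

variable {𝒲} {q : ZMod 2} {δ : GradedSym 𝒲 →ₗ[k] GradedSym 𝒲}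

namespace IsCoderivation

theorem conv {N : Type*} [AddCommGroup N] [Module k N] (hδ : IsCoderivation 𝒲 q δ)
    (B : GradedSym 𝒲 →ₗ[k] GradedSym 𝒲 →ₗ[k] N) (x : GradedSym 𝒲) :
    conv 𝒲 B (δ x) = conv 𝒲 (B ∘ₗ δ) x + conv 𝒲 (B.compl₁₂ (koszul (parity 𝒲) q) δ) x := by
  suffices TensorProduct.lift B ∘ₗ tensorDerivation (parity 𝒲) q δ =
      TensorProduct.lift (B ∘ₗ δ) + TensorProduct.lift (B.compl₁₂ (koszul (parity 𝒲) q) δ) from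
    (congrArg _ (LinearMap.congr_fun hδ.comul_comp x)).trans
      (LinearMap.congr_fun this (comul 𝒲 x))
  ext y z
  simp [tensorDerivation_tmul]

theorem counit_eq_zero (hδ : IsCoderivation 𝒲 q δ) (x : GradedSym 𝒲) : counit 𝒲 (δ x) = 0 := by
  have h := hδ.conv ((counit 𝒲).smulRight (counit 𝒲)) x
  have left : (counit 𝒲).smulRight (counit 𝒲) ∘ₗ δ =
      ((counit 𝒲).smulRight (counit 𝒲 ∘ₗ δ)).flip := by
    ext; simp [mul_comm]
  have right : ((counit 𝒲).smulRight (counit 𝒲)).compl₁₂ (koszul (parity 𝒲) q) δ =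
      (counit 𝒲).smulRight (counit 𝒲 ∘ₗ δ) := by
    ext; simp [counit_koszul]
  simpa [left, right, conv_counit_left, conv_counit_right] using h

theorem eq_zero (hδ : IsCoderivation 𝒲 q δ) (h0 : toBase 𝒲 ∘ₗ δ = 0) : δ = 0 := by
  refine hom_ext_monomial 𝒲 fun n => ?_
  induction n with
  | zero => simp [monomial_zero, hδ.map_one]
  | succ n ih =>
    intro b w hw
    let B := (LinearMap.mul k (GradedSym 𝒲)).compl₁₂ (ι 𝒲 ∘ₗ koszul 𝒲 q) δ
    have left : (LinearMap.mul k (GradedSym 𝒲) ∘ₗ ι 𝒲 ∘ₗ toBase 𝒲) ∘ₗ δ = 0 := by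
      simp only [LinearMap.comp_assoc, h0, LinearMap.comp_zero]
    have right : (LinearMap.mul k (GradedSym 𝒲) ∘ₗ ι 𝒲 ∘ₗ toBase 𝒲).compl₁₂
        (koszul (parity 𝒲) q) δ = B ∘ₗ toBase 𝒲 := by
      ext; simp [B, koszul_toBase]
    refine eq_zero_of_coder_toBase 𝒲 ?_ (hδ.counit_eq_zero _)
    rw [coder, hδ.conv, left, right, conv_zero, conv_comp_toBase_monomial_eq_zero B _ hw]
    · simp
    · intro u c z hz
      simp [B, ih c z hz]

theorem sub {δ' : GradedSym 𝒲 →ₗ[k] GradedSym 𝒲}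
    (h : IsCoderivation 𝒲 q δ) (h' : IsCoderivation 𝒲 q δ') : IsCoderivation 𝒲 q (δ - δ') where
  map_parity i x hx := sub_mem (h.map_parity i x hx) (h'.map_parity i x hx)
  map_one := by rw [LinearMap.sub_apply, h.map_one, h'.map_one, sub_zero]
  comul_comp := by
    refine .trans ?_ (congrArg (· ∘ₗ comul 𝒲) (tensorDerivation_sub (parity 𝒲) q δ δ').symm)
    rw [LinearMap.comp_sub, h.comul_comp, h'.comul_comp]
    rfl

theorem eq_of_toBase_eq {δ' : GradedSym 𝒲 →ₗ[k] GradedSym 𝒲}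
    (h : IsCoderivation 𝒲 q δ) (h' : IsCoderivation 𝒲 q δ')
    (he : toBase 𝒲 ∘ₗ δ = toBase 𝒲 ∘ₗ δ') : δ = δ' :=
  sub_eq_zero.mp <| (h.sub h').eq_zero <| by rw [LinearMap.comp_sub, he, sub_self]

theorem eq_coder (h : IsCoderivation 𝒲 q δ) : δ = coder 𝒲 (toBase 𝒲 ∘ₗ δ) := by
  refine h.eq_of_toBase_eq (isCoderivation_coder (q := q) ?_ ?_) (toBase_comp_coder 𝒲 _).symm
  · simpa using (hasParity_toBase 𝒲).comp h.map_parity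
  · rw [LinearMap.comp_apply, h.map_one, map_zero]

theorem commutator {p : ZMod 2} {D : GradedSym 𝒲 →ₗ[k] GradedSym 𝒲}
    (hδ : IsCoderivation 𝒲 q δ) (hD : IsCoderivation 𝒲 p D) :
    IsCoderivation 𝒲 (q + p) (δ ∘ₗ D - (-1 : ℤˣ) ^ (q * p) • D ∘ₗ δ) where
  map_parity i x hx := by
    have hDδ := HasParity.comp hD.map_parity hδ.map_parity i x hx
    rw [add_comm p] at hDδ
    exact sub_mem (HasParity.comp hδ.map_parity hD.map_parity i x hx)
      (Submodule.smul_of_tower_mem _ ((-1 : ℤˣ) ^ (q * p)) hDδ)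
  map_one := by simp [hδ.map_one, hD.map_one]
  comul_comp := by
    refine .trans ?_ (congrArg (· ∘ₗ comul 𝒲)
      (tensorDerivation_commutator hδ.map_parity hD.map_parity).symm)
    have hδx (x) : comul 𝒲 (δ x) = tensorDerivation (parity 𝒲) q δ (comul 𝒲 x) :=
      LinearMap.congr_fun hδ.comul_comp x
    have hDx (x) : comul 𝒲 (D x) = tensorDerivation (parity 𝒲) p D (comul 𝒲 x) :=
      LinearMap.congr_fun hD.comul_comp x
    ext x
    simp only [LinearMap.comp_apply, LinearMap.sub_apply, LinearMap.smul_apply, map_sub,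
      LinearMap.map_smul_of_tower, hδx, hDx]

end IsCoderivation

end Uniqueness

/-! ### Maps out of the graded symmetric algebra -/

section SymFamily

variable {k W N : Type*} [Field k] [AddCommGroup W] [Module k W] [AddCommGroup N] [Module k N]
variable (𝒲 : ZMod 2 → Submodule k W)

section Homogeneous

variable [DirectSum.Decomposition 𝒲]

theorem multilinear_ext_homogeneous {n : ℕ} {f g : MultilinearMap k (fun _ : Fin n => W) N}
    (h : ∀ (a : Fin n → ZMod 2) (v : Fin n → W), (∀ i, v i ∈ 𝒲 (a i)) → f v = g v) : f = g := by
  ext v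
  have hv : v = fun i => ∑ j : ZMod 2, proj 𝒲 j (v i) := funext fun i => (sum_proj 𝒲 (v i)).symm
  rw [hv, f.map_sum, g.map_sum]
  exact Finset.sum_congr rfl fun a _ => h a _ fun i => proj_mem 𝒲 (a i) (v i)

end Homogeneous

variable {𝒲} in
theorem snoc_mem {n : ℕ} {b : Fin n → ZMod 2} {v : Fin n → W} {c : ZMod 2} {w : W}
    (hv : ∀ j, v j ∈ 𝒲 (b j)) (hw : w ∈ 𝒲 c) (j : Fin (n + 1)) :
    (Fin.snoc v w : Fin (n + 1) → W) j ∈ 𝒲 ((Fin.snoc b c : Fin (n + 1) → ZMod 2) j) := by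
  cases j using Fin.lastCases with
  | last => simpa using hw
  | cast j => simpa using hv j

theorem snoc_comp_swap_castSucc {α : Type*} {n : ℕ} (v : Fin (n + 1) → α) (w : α) (i : Fin n) :
    (Fin.snoc v w : Fin (n + 2) → α) ∘ Equiv.swap i.castSucc.castSucc i.castSucc.succ =
      Fin.snoc (v ∘ Equiv.swap i.castSucc i.succ) w := by
  funext j
  cases j using Fin.lastCases with
  | last =>
    rw [Function.comp_apply, ← Fin.castSucc_succ,
      Equiv.swap_apply_of_ne_of_ne (Fin.castSucc_ne_last _).symm (Fin.castSucc_ne_last _).symm]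
    simp
  | cast j =>
    rw [Function.comp_apply, ← Fin.castSucc_succ, (Fin.castSucc_injective _).swap_apply]
    simp

theorem snoc_snoc_comp_swap {α : Type*} {n : ℕ} (x : Fin n → α) (u v : α) :
    (Fin.snoc (Fin.snoc x u : Fin (n + 1) → α) v : Fin (n + 2) → α) ∘
      Equiv.swap (Fin.last n).castSucc (Fin.last n).succ =
      Fin.snoc (Fin.snoc x v : Fin (n + 1) → α) u := by
  funext j
  rw [Function.comp_apply]
  cases j using Fin.lastCases with
  | last => rw [← Fin.succ_last, Equiv.swap_apply_right, Fin.succ_last]; simp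
  | cast j =>
    cases j using Fin.lastCases with
    | last => rw [Equiv.swap_apply_left, Fin.succ_last]; simp
    | cast j =>
      rw [Fin.succ_last, Equiv.swap_apply_of_ne_of_ne
        (by simp) (Fin.castSucc_ne_last _)]
      simp

variable (N) in
/-- Families `(φₙ)` of graded symmetric multilinear maps, the symmetry being imposed for adjacent
transpositions only. -/
def symFamily : Submodule k (∀ n : ℕ, MultilinearMap k (fun _ : Fin n => W) N) where
  carrier := {φ | ∀ (n : ℕ) (i : Fin n) (b : Fin (n + 1) → ZMod 2) (v : Fin (n + 1) → W),
    (∀ j, v j ∈ 𝒲 (b j)) → φ (n + 1) v = (-1 : ℤˣ) ^ (b i.castSucc * b i.succ) •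
      φ (n + 1) (v ∘ Equiv.swap i.castSucc i.succ)}
  add_mem' hφ hψ n i b v hv := by simp [hφ n i b v hv, hψ n i b v hv]
  zero_mem' _ _ _ _ _ := by simp
  smul_mem' c _ hφ n i b v hv := by simp [hφ n i b v hv, smul_comm c]

variable (k W N) in
/-- Insertion of a vector as the last argument of the members of a family of multilinear maps. -/
def contract : W →ₗ[k] Module.End k (∀ n : ℕ, MultilinearMap k (fun _ : Fin n => W) N) :=
  LinearMap.mk₂ k (fun w φ n => (LinearMap.applyₗ w).compMultilinearMap (φ (n + 1)).curryRight)
    (by intros; ext; simp) (by intros; ext; simp) (by intros; ext; simp) (by intros; ext; simp)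

theorem contract_apply (w : W) (φ : ∀ n : ℕ, MultilinearMap k (fun _ : Fin n => W) N) (n : ℕ)
    (v : Fin n → W) : contract k W N w φ n v = φ (n + 1) (Fin.snoc v w) := by
  simp [contract]

variable [DirectSum.Decomposition 𝒲]

theorem contract_mem {φ : ∀ n : ℕ, MultilinearMap k (fun _ : Fin n => W) N}
    (hφ : φ ∈ symFamily N 𝒲) (w : W) : contract k W N w φ ∈ symFamily N 𝒲 := by
  suffices ∀ (c : ZMod 2) (w : W), w ∈ 𝒲 c → contract k W N w φ ∈ symFamily N 𝒲 by
    rw [← sum_proj 𝒲 w, map_sum, LinearMap.sum_apply]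
    exact sum_mem fun c _ => this c _ (proj_mem 𝒲 c w)
  intro c w hw n i b v hv
  rw [contract_apply, contract_apply, hφ (n + 1) i.castSucc _ _ (snoc_mem hv hw),
    snoc_comp_swap_castSucc, ← Fin.castSucc_succ]
  simp only [Fin.snoc_castSucc]

theorem contract_comm {φ : ∀ n : ℕ, MultilinearMap k (fun _ : Fin n => W) N}
    (hφ : φ ∈ symFamily N 𝒲) {i j : ZMod 2} {u v : W} (hu : u ∈ 𝒲 i) (hv : v ∈ 𝒲 j) :
    contract k W N u (contract k W N v φ) =
      (-1 : ℤˣ) ^ (i * j) • contract k W N v (contract k W N u φ) := by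
  funext n
  refine multilinear_ext_homogeneous 𝒲 fun a x hx => ?_
  rw [Pi.smul_apply, smul_apply]
  simp only [contract_apply]
  rw [hφ (n + 1) (Fin.last n) _ _ (snoc_mem (snoc_mem hx hu) hv), snoc_snoc_comp_swap,
    Fin.succ_last]
  simp only [Fin.snoc_castSucc, Fin.snoc_last]

namespace GradedSym

variable (N) in
/-- The action of the graded symmetric algebra on families of graded symmetric multilinear maps in
which the elements of `W` act by insertion. -/
def contractSym : GradedSym 𝒲 →ₐ[k] Module.End k (symFamily N 𝒲) :=
  lift 𝒲
    { toFun := fun w => (contract k W N w).restrict fun _ hφ => contract_mem 𝒲 hφ w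
      map_add' := by intro w w'; ext φ; simp
      map_smul' := by intro c w; ext φ; simp }
    fun _ _ _ _ hu hv => LinearMap.ext fun φ => Subtype.ext (contract_comm 𝒲 φ.2 hu hv)

/-- The linear map on the graded symmetric algebra with a given family of graded symmetric
multilinear maps: `x` acts on the family, and the result is evaluated at the empty tuple. -/
def ofSymFamily (φ : symFamily N 𝒲) : GradedSym 𝒲 →ₗ[k] N where
  toFun x := (contractSym N 𝒲 x φ).1 0 Fin.elim0
  map_add' := by intro x y; simp
  map_smul' := by intro c x; simp

theorem ofSymFamily_mul_ι (φ : symFamily N 𝒲) (x : GradedSym 𝒲) (w : W) :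
    ofSymFamily 𝒲 φ (x * ι 𝒲 w) =
      ofSymFamily 𝒲 ⟨contract k W N w φ.1, contract_mem 𝒲 φ.2 w⟩ x := by
  have contractSym_ι : contractSym N 𝒲 (ι 𝒲 w) φ =
      ⟨contract k W N w φ.1, contract_mem 𝒲 φ.2 w⟩ := by
    rw [contractSym, lift_ι]
    rfl
  simp only [ofSymFamily, LinearMap.coe_mk, AddHom.coe_mk, map_mul, Module.End.mul_apply,
    contractSym_ι]

theorem ofSymFamily_monomial (φ : symFamily N 𝒲) {n : ℕ} (w : Fin n → W) :
    ofSymFamily 𝒲 φ (monomial 𝒲 w) = φ.1 n w := by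
  induction n generalizing φ with
  | zero =>
    simp only [ofSymFamily, LinearMap.coe_mk, AddHom.coe_mk, monomial_zero, map_one,
      Module.End.one_apply]
    exact congrArg _ (Subsingleton.elim _ _)
  | succ n ih =>
    rw [← Fin.snoc_init_self w, monomial_snoc, ofSymFamily_mul_ι, ih, contract_apply]

end GradedSym

end SymFamily

/-! ### Structure maps -/

section Bijection

variable {k V : Type*} [Field k] [AddCommGroup V] [Module k V]
variable {𝒱 : ZMod 2 → Submodule k V}

open GradedSym

theorem mem_parityRev {i : ZMod 2} {v : V} (hv : v ∈ 𝒱 i) : v ∈ parityRev 𝒱 (i + 1) := by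
  rwa [parityRev, add_assoc, CharTwo.add_self_eq_zero, add_zero]

theorem sum_add_one {n : ℕ} (a : Fin (n + 1) → ZMod 2) :
    ∑ i, (a i + 1) = ∑ i, a i + (n + 1) := by
  simp [Finset.sum_add_distrib]

variable [DirectSum.Decomposition 𝒱]

theorem structureMaps_eq_monomial (δ : SymRev 𝒱 →ₗ[k] SymRev 𝒱) {n : ℕ} {a : Fin (n + 1) → ZMod 2}
    {v : Fin (n + 1) → V} (hv : ∀ i, v i ∈ 𝒱 (a i)) :
    structureMaps 𝒱 δ n v =
      etaSign a • toBase (parityRev 𝒱) (δ (monomial (parityRev 𝒱) v)) :=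
  structureMaps_apply 𝒱 δ hv

theorem toBase_monomial (δ : SymRev 𝒱 →ₗ[k] SymRev 𝒱) {n : ℕ} {a : Fin (n + 1) → ZMod 2}
    {v : Fin (n + 1) → V} (hv : ∀ i, v i ∈ 𝒱 (a i)) :
    toBase (parityRev 𝒱) (δ (monomial (parityRev 𝒱) v)) = etaSign a • structureMaps 𝒱 δ n v := by
  rw [structureMaps_eq_monomial δ hv, smul_smul, Int.units_mul_self, one_smul]

theorem toBase_comp_eq_of_structureMaps_eq {δ δ' : SymRev 𝒱 →ₗ[k] SymRev 𝒱} (h1 : δ 1 = δ' 1)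
    (h : structureMaps 𝒱 δ = structureMaps 𝒱 δ') :
    toBase (parityRev 𝒱) ∘ₗ δ = toBase (parityRev 𝒱) ∘ₗ δ' := by
  refine hom_ext_monomial _ fun n b w hw => ?_
  cases n with
  | zero => simp only [monomial_zero, LinearMap.comp_apply, h1]
  | succ n =>
    rw [LinearMap.comp_apply, LinearMap.comp_apply, toBase_monomial δ hw, h, toBase_monomial δ' hw]

variable (𝒱) in
/-- The family of maps `⨀ⁿ ΠV → ΠV` corresponding to a family of maps `⋀ⁿ V → V`; its member for
`n = 0` is zero. -/
def symOfAlt (φ : Family k V) : ∀ n : ℕ, MultilinearMap k (fun _ : Fin n => V) V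
  | 0 => 0
  | n + 1 => glue 𝒱 fun a => etaSign a • φ n

theorem symOfAlt_succ (φ : Family k V) {n : ℕ} {a : Fin (n + 1) → ZMod 2} {v : Fin (n + 1) → V}
    (hv : ∀ i, v i ∈ 𝒱 (a i)) : symOfAlt 𝒱 φ (n + 1) v = etaSign a • φ n v := by
  rw [symOfAlt, glue_apply 𝒱 _ hv, smul_apply]

theorem symOfAlt_mem {q : ZMod 2} {φ : Family k V} (hφ : φ ∈ cochains 𝒱 q) :
    symOfAlt 𝒱 φ ∈ symFamily V (parityRev 𝒱) := by
  intro n i b v (hv : ∀ j, v j ∈ 𝒱 (b j + 1))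
  set τ := Equiv.swap i.castSucc i.succ
  have add_one_add_one : (fun j => b j + 1 + 1) = b := by
    funext j; rw [add_assoc, CharTwo.add_self_eq_zero, add_zero]
  have sign_eq : etaSign (fun j => b j + 1) * (Equiv.Perm.sign τ * koszulSign τ fun j => b j + 1) =
      koszulSign τ b * etaSign ((fun j => b j + 1) ∘ τ) := by
    have h := etaSign_mul_koszulSign τ (fun j => b j + 1)
    rw [add_one_add_one] at h
    rw [← Int.units_inv_eq_self (koszulSign τ b), eq_inv_mul_iff_mul_eq, ← mul_assoc,
      mul_comm (koszulSign τ b), h, mul_right_comm, Int.units_mul_self, one_mul]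
  rw [symOfAlt_succ φ hv, (hφ n trivial _ v hv).2 τ, smul_smul, sign_eq, koszulSign_swap,
    symOfAlt_succ φ (v := v ∘ τ) (a := (fun j => b j + 1) ∘ τ) fun j => hv (τ j), smul_smul]
  rfl

section Coderivation

variable [CharZero k]

theorem structureMaps_mem_cochains {q : ZMod 2} {δ : SymRev 𝒱 →ₗ[k] SymRev 𝒱}
    (h : IsCoderivation (parityRev 𝒱) q δ) : structureMaps 𝒱 δ ∈ cochains 𝒱 q := by
  intro n _ a v hv
  have hw (i) : v i ∈ parityRev 𝒱 (a i + 1) := mem_parityRev (hv i)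
  rw [structureMaps_eq_monomial δ hv]
  constructor
  · have toBase_mem : toBase (parityRev 𝒱) (δ (monomial (parityRev 𝒱) v)) ∈
        𝒱 (∑ i, (a i + 1) + q + 1) := by
      have := hasParity_toBase (parityRev 𝒱) _ _ (h.map_parity _ _ (monomial_mem_parity hw))
      rwa [add_zero] at this
    convert Submodule.smul_of_tower_mem _ (etaSign a) toBase_mem using 2
    rw [sum_add_one]
    linear_combination -CharTwo.add_self_eq_zero (1 : ZMod 2)
  · intro σ
    rw [structureMaps_eq_monomial δ fun i => hv (σ i), monomial_perm σ hw,
      LinearMap.map_smul_of_tower, LinearMap.map_smul_of_tower, smul_smul, smul_smul,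
      etaSign_mul_koszulSign]
    rfl

theorem IsCoderivation.eq_of_structureMaps_eq {q : ZMod 2} {δ δ' : SymRev 𝒱 →ₗ[k] SymRev 𝒱}
    (hδ : IsCoderivation (parityRev 𝒱) q δ) (hδ' : IsCoderivation (parityRev 𝒱) q δ')
    (h : structureMaps 𝒱 δ = structureMaps 𝒱 δ') : δ = δ' :=
  hδ.eq_of_toBase_eq hδ'
    (toBase_comp_eq_of_structureMaps_eq (hδ.map_one.trans hδ'.map_one.symm) h)

theorem exists_hom_monomial {q : ZMod 2} {φ : Family k V} (hφ : φ ∈ cochains 𝒱 q) :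
    ∃ f : SymRev 𝒱 →ₗ[k] V, HasParity (parity (parityRev 𝒱)) (parityRev 𝒱) q f ∧ f 1 = 0 ∧
      ∀ (n : ℕ) (a : Fin (n + 1) → ZMod 2) (v : Fin (n + 1) → V), (∀ i, v i ∈ 𝒱 (a i)) →
        f (monomial (parityRev 𝒱) v) = etaSign a • φ n v := by
  have f_monomial := @ofSymFamily_monomial _ _ _ _ _ _ _ _ (parityRev 𝒱) _
    ⟨symOfAlt 𝒱 φ, symOfAlt_mem hφ⟩
  set f := ofSymFamily (parityRev 𝒱) ⟨symOfAlt 𝒱 φ, symOfAlt_mem hφ⟩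
  have f_one : f 1 = 0 := by
    simpa [monomial_zero, symOfAlt] using f_monomial (n := 0) Fin.elim0
  have f_succ (n : ℕ) (a : Fin (n + 1) → ZMod 2) (v : Fin (n + 1) → V)
      (hv : ∀ i, v i ∈ 𝒱 (a i)) : f (monomial (parityRev 𝒱) v) = etaSign a • φ n v :=
    (f_monomial v).trans (symOfAlt_succ φ hv)
  refine ⟨f, hasParity_of_monomial _ fun n b w hw => ?_, f_one, f_succ⟩
  cases n with
  | zero => rw [monomial_zero, f_one]; exact zero_mem _
  | succ n =>
    rw [f_succ n _ w hw, parityRev]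
    have smul_mem := Submodule.smul_of_tower_mem _ (etaSign fun j => b j + 1)
      (hφ n trivial _ w hw).1
    convert smul_mem using 2
    rw [sum_add_one]
    linear_combination -CharTwo.add_self_eq_zero (n : ZMod 2)

theorem exists_coderivation {q : ZMod 2} {φ : Family k V} (hφ : φ ∈ cochains 𝒱 q) :
    ∃ δ, IsCoderivation (parityRev 𝒱) q δ ∧ structureMaps 𝒱 δ = φ := by
  obtain ⟨f, hf, f_one, f_monomial⟩ := exists_hom_monomial hφ
  refine ⟨coder (parityRev 𝒱) f, isCoderivation_coder hf f_one, ?_⟩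
  funext n
  refine multilinear_ext_homogeneous 𝒱 fun a v hv => ?_
  rw [structureMaps_eq_monomial _ hv, ← LinearMap.comp_apply, toBase_comp_coder,
    f_monomial n a v hv, smul_smul, Int.units_mul_self, one_smul]

theorem bijOn_structureMaps (q : ZMod 2) :
    Set.BijOn (structureMaps 𝒱) {δ | IsCoderivation (parityRev 𝒱) q δ} (cochains 𝒱 q) :=
  ⟨fun _ => structureMaps_mem_cochains, fun _ h _ h' => h.eq_of_structureMaps_eq h',
    fun _ => exists_coderivation⟩

end Coderivation

end Bijection

/-! ### Commutators with the coderivation of a bracket -/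

namespace IsCoderivation

open GradedSym

variable {k W : Type*} [Field k] [CharZero k] [AddCommGroup W] [Module k W]
variable {𝒲 : ZMod 2 → Submodule k W} [DirectSum.Decomposition 𝒲] {q : ZMod 2}
variable {δ : GradedSym 𝒲 →ₗ[k] GradedSym 𝒲}

theorem apply_monomial (hδ : IsCoderivation 𝒲 q δ) {n : ℕ} {b : Fin n → ZMod 2} {w : Fin n → W}
    (hw : ∀ j, w j ∈ 𝒲 (b j)) :
    δ (monomial 𝒲 w) = ∑ p : Fin (n + 1), ∑ σ ∈ unshuffles p n, koszulSign σ b •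
      (ι 𝒲 (toBase 𝒲 (δ (takeMonomial 𝒲 p (w ∘ σ)))) * dropMonomial 𝒲 p (w ∘ σ)) := by
  rw [LinearMap.congr_fun hδ.eq_coder]
  exact conv_monomial _ hw

theorem apply_ι (hδ : IsCoderivation 𝒲 q δ) (w : W) : δ (ι 𝒲 w) = ι 𝒲 (toBase 𝒲 (δ (ι 𝒲 w))) := by
  conv_lhs => rw [hδ.eq_coder]
  simp [coder, GradedSym.conv, comul_ι, hδ.map_one]

end IsCoderivation

section EtaSign

theorem etaSign_cons_add {m : ℕ} (a : Fin (m + 2) → ZMod 2) :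
    etaSign (Fin.cons (a 0 + a 1) (Fin.tail (Fin.tail a)) : Fin (m + 1) → ZMod 2) =
      etaSign a * (-1 : ℤˣ) ^ a 0 := by
  rw [etaSign, etaSign, ← uzpow_add, Fin.sum_univ_succ, Fin.sum_univ_succ (n := m + 1),
    Fin.sum_univ_succ (n := m)]
  simp only [Fin.cons_zero, Fin.cons_succ, Fin.val_succ, Fin.val_zero, Nat.add_sub_cancel,
    Nat.sub_zero, Fin.tail]
  rw [Fin.succ_zero_eq_one]
  congr 1
  push_cast
  linear_combination -CharTwo.add_self_eq_zero (a 0)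

theorem etaSign_eq_init {m : ℕ} (a : Fin (m + 2) → ZMod 2) :
    etaSign a = etaSign (Fin.init a : Fin (m + 1) → ZMod 2) *
      (-1 : ℤˣ) ^ ∑ i : Fin (m + 1), (Fin.init a : Fin (m + 1) → ZMod 2) i := by
  have weight (i : Fin (m + 1)) : m + 1 - (i : ℕ) = m - i + 1 := by omega
  rw [etaSign, etaSign, ← uzpow_add, Fin.sum_univ_castSucc, ← Finset.sum_add_distrib]
  simp [Fin.init, weight, add_mul]

theorem etaSign_mul_koszulSign_mul_etaSign {n : ℕ} (σ : Equiv.Perm (Fin (n + 1)))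
    (a : Fin (n + 1) → ZMod 2) :
    etaSign a * koszulSign σ (fun i => a i + 1) * etaSign (a ∘ σ) =
      Equiv.Perm.sign σ * koszulSign σ a := by
  rw [etaSign_mul_koszulSign, mul_assoc, Int.units_mul_self, mul_one]

end EtaSign

section Comparison

variable {k V : Type*} [Field k] [AddCommGroup V] [Module k V]
variable {𝒱 : ZMod 2 → Submodule k V} [DirectSum.Decomposition 𝒱]

open GradedSym

theorem structureMaps_sub (δ δ' : SymRev 𝒱 →ₗ[k] SymRev 𝒱) :
    structureMaps 𝒱 (δ - δ') = structureMaps 𝒱 δ - structureMaps 𝒱 δ' := by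
  funext n
  refine multilinear_ext_homogeneous 𝒱 fun a v hv => ?_
  rw [Pi.sub_apply, sub_apply]
  simp only [structureMaps_eq_monomial _ hv, LinearMap.sub_apply, map_sub, smul_sub]

theorem structureMaps_zero : structureMaps 𝒱 (0 : SymRev 𝒱 →ₗ[k] SymRev 𝒱) = 0 := by
  rw [← sub_self (0 : SymRev 𝒱 →ₗ[k] SymRev 𝒱), structureMaps_sub, sub_self]

theorem structureMaps_units_smul (u : ℤˣ) (δ : SymRev 𝒱 →ₗ[k] SymRev 𝒱) :
    structureMaps 𝒱 (u • δ) = u • structureMaps 𝒱 δ := by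
  funext n
  refine multilinear_ext_homogeneous 𝒱 fun a v hv => ?_
  rw [Pi.smul_apply, smul_apply]
  simp only [structureMaps_eq_monomial _ hv, LinearMap.smul_apply, LinearMap.map_smul_of_tower,
    smul_smul, mul_comm]

variable [CharZero k]

theorem IsCoderivation.eq_zero_of_structureMaps_eq_zero {q : ZMod 2}
    {δ : SymRev 𝒱 →ₗ[k] SymRev 𝒱} (hδ : IsCoderivation (parityRev 𝒱) q δ)
    (h : structureMaps 𝒱 δ = 0) : δ = 0 :=
  hδ.eq_zero <| (toBase_comp_eq_of_structureMaps_eq (δ' := 0) hδ.map_one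
    (h.trans structureMaps_zero.symm)).trans (LinearMap.comp_zero _)

/-- The odd coderivations of the symmetric coalgebra of `ΠV` whose only structure map is the binary
bracket `l`; they are not required to square to zero. -/
structure IsBracketCoderivation (l : V →ₗ[k] V →ₗ[k] V) (D : SymRev 𝒱 →ₗ[k] SymRev 𝒱) :
    Prop where
  isCoderivation : IsCoderivation (parityRev 𝒱) 1 D
  structureMaps_one : ∀ v : Fin 2 → V, structureMaps 𝒱 D 1 v = l (v 0) (v 1)
  structureMaps_of_ne_one : ∀ n ≠ 1, structureMaps 𝒱 D n = 0

namespace IsBracketCoderivation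

variable {l : V →ₗ[k] V →ₗ[k] V} {D : SymRev 𝒱 →ₗ[k] SymRev 𝒱} (hD : IsBracketCoderivation l D)
include hD

theorem bracket_mem {i j : ZMod 2} {u v : V} (hu : u ∈ 𝒱 i) (hv : v ∈ 𝒱 j) :
    l u v ∈ 𝒱 (i + j) := by
  have h := (structureMaps_mem_cochains hD.isCoderivation 1 trivial ![i, j] ![u, v]
    (Fin.forall_fin_two.mpr ⟨hu, hv⟩)).1
  simpa [hD.structureMaps_one, CharTwo.add_self_eq_zero] using h

theorem toBase_ι_mul_ι {i j : ZMod 2} {u v : V} (hu : u ∈ 𝒱 i) (hv : v ∈ 𝒱 j) :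
    toBase (parityRev 𝒱) (D (ι (parityRev 𝒱) u * ι (parityRev 𝒱) v)) = (-1 : ℤˣ) ^ i • l u v := by
  have h := toBase_monomial D (a := ![i, j]) (v := ![u, v]) (Fin.forall_fin_two.mpr ⟨hu, hv⟩)
  simpa [hD.structureMaps_one, monomial, etaSign] using h

theorem toBase_monomial_eq_zero {n : ℕ} (hn : n ≠ 2) (v : Fin n → V) :
    toBase (parityRev 𝒱) (D (monomial (parityRev 𝒱) v)) = 0 := by
  let F := (toBase (parityRev 𝒱) ∘ₗ D).compMultilinearMap
    ((MultilinearMap.mkPiAlgebraFin k n (SymRev 𝒱)).compLinearMap fun _ => ι (parityRev 𝒱))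
  suffices F = 0 by simpa [F, monomial] using congrArg (· v) this
  refine multilinear_ext_homogeneous 𝒱 fun a w hw => ?_
  change toBase (parityRev 𝒱) (D (monomial (parityRev 𝒱) w)) = 0
  cases n with
  | zero => rw [monomial_zero, hD.isCoderivation.map_one, map_zero]
  | succ n =>
    rw [toBase_monomial D hw, hD.structureMaps_of_ne_one n (by omega), zero_apply, smul_zero]

theorem apply_ι (u : V) : D (ι (parityRev 𝒱) u) = 0 := by
  have h := hD.toBase_monomial_eq_zero (n := 1) (by simp) fun _ => u
  rw [monomial_succ, monomial_zero, mul_one] at h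
  rw [hD.isCoderivation.apply_ι, h, map_zero]

theorem toBase_apply_take_two_mul_drop_two {δ : SymRev 𝒱 →ₗ[k] SymRev 𝒱} {m : ℕ}
    {a : Fin (m + 2) → ZMod 2} {v : Fin (m + 2) → V} (hv : ∀ i, v i ∈ 𝒱 (a i)) :
    toBase (parityRev 𝒱) (δ (ι (parityRev 𝒱) (toBase (parityRev 𝒱)
      (D (takeMonomial (parityRev 𝒱) 2 v))) * dropMonomial (parityRev 𝒱) 2 v)) =
      etaSign a • structureMaps 𝒱 δ m (Fin.cons (l (v 0) (v 1)) (Fin.tail (Fin.tail v))) := by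
  have cons_mem : ∀ j : Fin (m + 1),
      (Fin.cons (l (v 0) (v 1)) (Fin.tail (Fin.tail v)) : Fin (m + 1) → V) j ∈
      𝒱 ((Fin.cons (a 0 + a 1) (Fin.tail (Fin.tail a)) : Fin (m + 1) → ZMod 2) j) :=
    Fin.cases (hD.bracket_mem (hv 0) (hv 1)) fun j => hv j.succ.succ
  have take_two : takeMonomial (parityRev 𝒱) 2 v =
      ι (parityRev 𝒱) (v 0) * ι (parityRev 𝒱) (v 1) := by
    simp [takeMonomial_succ, takeMonomial_zero, Fin.tail]
  rw [take_two, hD.toBase_ι_mul_ι (hv 0) (hv 1), dropMonomial_succ, dropMonomial_succ,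
    dropMonomial_zero, LinearMap.map_smul_of_tower, smul_mul_assoc, ← monomial_cons,
    LinearMap.map_smul_of_tower, LinearMap.map_smul_of_tower, toBase_monomial δ cons_mem,
    etaSign_cons_add, smul_smul, mul_left_comm, Int.units_mul_self, mul_one]

theorem toBase_apply_init_mul_last {q : ZMod 2} {δ : SymRev 𝒱 →ₗ[k] SymRev 𝒱}
    (hδ : IsCoderivation (parityRev 𝒱) q δ) {m : ℕ} {a : Fin (m + 2) → ZMod 2}
    {v : Fin (m + 2) → V} (hv : ∀ i, v i ∈ 𝒱 (a i)) :
    toBase (parityRev 𝒱) (D (ι (parityRev 𝒱) (toBase (parityRev 𝒱)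
      (δ (takeMonomial (parityRev 𝒱) (m + 1) v))) * dropMonomial (parityRev 𝒱) (m + 1) v)) =
      etaSign a • (-1 : ℤˣ) ^ (q + m) •
        l (structureMaps 𝒱 δ m (Fin.init v)) (v (Fin.last (m + 1))) := by
  have init_mem (i) : (Fin.init v : Fin (m + 1) → V) i ∈
      𝒱 ((Fin.init a : Fin (m + 1) → ZMod 2) i) := hv i.castSucc
  have hφ := (structureMaps_mem_cochains hδ m trivial _ _ init_mem).1
  rw [takeMonomial_last, dropMonomial_last, toBase_monomial δ init_mem,
    LinearMap.map_smul_of_tower, smul_mul_assoc, LinearMap.map_smul_of_tower,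
    LinearMap.map_smul_of_tower, hD.toBase_ι_mul_ι hφ (hv _), uzpow_add _ (q + m), etaSign_eq_init,
    smul_smul, smul_smul, mul_comm ((-1) ^ (q + (m : ZMod 2))), ← mul_assoc]

theorem structureMaps_comp (δ : SymRev 𝒱 →ₗ[k] SymRev 𝒱) {m : ℕ}
    {a : Fin (m + 2) → ZMod 2} {v : Fin (m + 2) → V} (hv : ∀ i, v i ∈ 𝒱 (a i)) :
    structureMaps 𝒱 (δ ∘ₗ D) (m + 1) v =
      ∑ σ ∈ unshuffles 2 (m + 2), (Equiv.Perm.sign σ * koszulSign σ a) •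
        structureMaps 𝒱 δ m (Fin.cons (l (v (σ 0)) (v (σ 1))) fun i : Fin m =>
          v (σ i.succ.succ)) := by
  rw [structureMaps_eq_monomial _ hv, LinearMap.comp_apply,
    hD.isCoderivation.apply_monomial fun i => mem_parityRev (hv i), map_sum, map_sum,
    Finset.sum_eq_single (2 : Fin (m + 3))]
  · rw [Fin.val_two, map_sum, map_sum, Finset.smul_sum]
    refine Finset.sum_congr rfl fun σ _ => ?_
    rw [LinearMap.map_smul_of_tower, LinearMap.map_smul_of_tower,
      hD.toBase_apply_take_two_mul_drop_two (v := v ∘ σ) (a := a ∘ σ) fun i => hv (σ i),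
      smul_smul, smul_smul, etaSign_mul_koszulSign_mul_etaSign]
    rfl
  · intro p _ hp
    have hp' : (p : ℕ) ≠ 2 := fun h => hp (Fin.ext h)
    simp only [takeMonomial_eq_monomial _ p.is_le,
      hD.toBase_monomial_eq_zero hp', map_zero, zero_mul, smul_zero, Finset.sum_const_zero]
  · simp

theorem comp_structureMaps {q : ZMod 2} {δ : SymRev 𝒱 →ₗ[k] SymRev 𝒱}
    (hδ : IsCoderivation (parityRev 𝒱) q δ) {m : ℕ}
    {a : Fin (m + 2) → ZMod 2} {v : Fin (m + 2) → V} (hv : ∀ i, v i ∈ 𝒱 (a i)) :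
    structureMaps 𝒱 (D ∘ₗ δ) (m + 1) v =
      (-1 : ℤˣ) ^ (q + m) • ∑ σ ∈ unshuffles (m + 1) (m + 2),
        (Equiv.Perm.sign σ * koszulSign σ a) •
          l (structureMaps 𝒱 δ m fun i => v (σ i.castSucc)) (v (σ (Fin.last (m + 1)))) := by
  rw [structureMaps_eq_monomial _ hv, LinearMap.comp_apply,
    hδ.apply_monomial fun i => mem_parityRev (hv i), map_sum, map_sum,
    Finset.sum_eq_single (Fin.last (m + 1)).castSucc]
  · rw [Fin.val_castSucc, Fin.val_last, map_sum, map_sum, Finset.smul_sum, Finset.smul_sum]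
    refine Finset.sum_congr rfl fun σ _ => ?_
    rw [LinearMap.map_smul_of_tower, LinearMap.map_smul_of_tower,
      hD.toBase_apply_init_mul_last hδ (v := v ∘ σ) (a := a ∘ σ) fun i => hv (σ i),
      smul_smul, smul_smul, etaSign_mul_koszulSign_mul_etaSign, smul_comm]
    rfl
  · intro p _ hp
    have hp' : m + 2 - p + 1 ≠ 2 := fun h => hp (Fin.ext (by simp; omega))
    simp only [dropMonomial_eq_monomial, ← monomial_cons,
      LinearMap.map_smul_of_tower, map_sum,
      hD.toBase_monomial_eq_zero hp', smul_zero, Finset.sum_const_zero]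
  · simp

theorem structureMaps_commutator {q : ZMod 2} {δ : SymRev 𝒱 →ₗ[k] SymRev 𝒱}
    (hδ : IsCoderivation (parityRev 𝒱) q δ) :
    structureMaps 𝒱 (δ ∘ₗ D - (-1 : ℤˣ) ^ q • (D ∘ₗ δ)) = lieDiff 𝒱 l (structureMaps 𝒱 δ) := by
  funext n
  refine multilinear_ext_homogeneous 𝒱 fun a v hv => ?_
  cases n with
  | zero =>
    have D_δ : D (δ (ι (parityRev 𝒱) (v 0))) = 0 := by rw [hδ.apply_ι, hD.apply_ι]
    rw [structureMaps_eq_monomial _ hv, monomial_succ, monomial_zero, mul_one,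
      LinearMap.sub_apply, LinearMap.smul_apply, LinearMap.comp_apply, LinearMap.comp_apply,
      hD.apply_ι, D_δ, map_zero, smul_zero, sub_zero, map_zero, smul_zero]
    rfl
  | succ m =>
    have sign : (-1 : ℤˣ) ^ q * (-1 : ℤˣ) ^ (q + (m : ZMod 2)) = (-1 : ℤˣ) ^ m := by
      rw [uzpow_add, ← mul_assoc, Int.units_mul_self, one_mul, uzpow_natCast]
    change _ = lieCoboundary 𝒱 l (structureMaps 𝒱 δ m) v
    rw [structureMaps_sub, structureMaps_units_smul, Pi.sub_apply, Pi.smul_apply, sub_apply,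
      smul_apply, hD.structureMaps_comp δ hv, hD.comp_structureMaps hδ hv, smul_smul, sign,
      lieCoboundary_apply 𝒱 l _ hv]

end IsBracketCoderivation

end Comparison

/-! ### The `L∞` structure of a Lie superalgebra -/

section Existence

variable {k V : Type*} [Field k] [AddCommGroup V] [Module k V]
variable {𝒱 : ZMod 2 → Submodule k V}

theorem unshuffles_two_three :
    unshuffles 2 3 = {1, Equiv.swap 1 2, finRotate 3} := by
  ext σ
  simp only [mem_unshuffles, Finset.mem_insert, Finset.mem_singleton]
  revert σ
  decide

/-- The family of multilinear maps whose only nonzero member is the bracket `l`. -/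
def bracketFamily (l : V →ₗ[k] V →ₗ[k] V) : Family k V
  | 1 => compInner l (MultilinearMap.ofSubsingleton k V V (0 : Fin 1) LinearMap.id)
  | _ => 0

theorem bracketFamily_one (l : V →ₗ[k] V →ₗ[k] V) (v : Fin 2 → V) :
    bracketFamily l 1 v = l (v 0) (v 1) := rfl

theorem bracketFamily_of_ne_one (l : V →ₗ[k] V →ₗ[k] V) {n : ℕ} (hn : n ≠ 1) :
    bracketFamily l n = 0 := by
  match n with
  | 0 => rfl
  | 1 => exact absurd rfl hn
  | n + 2 => rfl

namespace IsLieSuperalgebra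

variable {l : V →ₗ[k] V →ₗ[k] V}

variable (hl : IsLieSuperalgebra 𝒱 l)
include hl

theorem cyclic_jacobi {a : Fin 3 → ZMod 2} {v : Fin 3 → V} (hv : ∀ i, v i ∈ 𝒱 (a i)) :
    l (l (v 0) (v 1)) (v 2) - (-1 : ℤˣ) ^ (a 1 * a 2) • l (l (v 0) (v 2)) (v 1) +
      (-1 : ℤˣ) ^ (a 0 * a 1 + a 0 * a 2) • l (l (v 1) (v 2)) (v 0) = 0 := by
  rw [hl.skew _ _ _ _ (hl.even _ _ _ _ (hv 0) (hv 2)) (hv 1),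
    hl.skew _ _ _ _ (hl.even _ _ _ _ (hv 1) (hv 2)) (hv 0), hl.jacobi _ _ _ _ (v 2) (hv 0) (hv 1),
    smul_neg, smul_neg, smul_smul, smul_smul, ← uzpow_add, ← uzpow_add]
  have h0 : a 0 * a 1 + a 0 * a 2 + (a 1 + a 2) * a 0 = 0 := by
    linear_combination (a 0 * a 1 + a 0 * a 2) * CharTwo.two_eq_zero (R := ZMod 2)
  have h1 : a 1 * a 2 + (a 0 + a 2) * a 1 = a 0 * a 1 := by
    linear_combination (a 1 * a 2) * CharTwo.two_eq_zero (R := ZMod 2)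
  rw [h0, h1, uzpow_zero, one_smul]
  abel

theorem sum_unshuffles_bracket_bracket {a : Fin 3 → ZMod 2} {v : Fin 3 → V}
    (hv : ∀ i, v i ∈ 𝒱 (a i)) :
    ∑ σ ∈ unshuffles 2 3, (Equiv.Perm.sign σ * koszulSign σ a) •
      l (l (v (σ 0)) (v (σ 1))) (v (σ 2)) = 0 := by
  rw [unshuffles_two_three, Finset.sum_insert (by decide), Finset.sum_insert (by decide),
    Finset.sum_singleton, ← hl.cyclic_jacobi hv]
  have koszulSign_swap' : koszulSign (Equiv.swap 1 2) a = (-1 : ℤˣ) ^ (a 1 * a 2) :=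
    koszulSign_swap 1 a
  have koszulSign_rotate :
      koszulSign (finRotate 3) a = (-1 : ℤˣ) ^ (a 0 * a 1 + a 0 * a 2) := by
    simp [koszulSign, Fin.prod_univ_three, uzpow_add, mul_comm]
  rw [koszulSign_one, koszulSign_swap', koszulSign_rotate, Equiv.Perm.sign_one,
    Equiv.Perm.sign_swap (by decide), sign_finRotate]
  simp [show Equiv.swap (1 : Fin 3) 2 0 = 0 from rfl, sub_eq_add_neg, add_assoc]

theorem bracketFamily_mem_cochains : bracketFamily l ∈ cochains 𝒱 1 := by
  intro n _
  obtain rfl | hn := eq_or_ne n 1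
  · intro a v hv
    refine ⟨?_, fun σ => ?_⟩
    · rw [bracketFamily_one, Fin.sum_univ_two, Nat.cast_one, CharTwo.add_self_eq_zero, zero_add]
      exact hl.even _ _ _ _ (hv 0) (hv 1)
    · rw [bracketFamily_one, bracketFamily_one]
      obtain rfl | rfl : σ = 1 ∨ σ = Equiv.swap 0 1 := by
        revert σ
        decide
      · simp [koszulSign_one]
      · rw [Equiv.Perm.sign_swap (by decide), neg_one_mul, Units.neg_smul,
          show koszulSign (Equiv.swap 0 1) a = (-1 : ℤˣ) ^ (a 0 * a 1) from koszulSign_swap 0 a]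
        exact hl.skew _ _ _ _ (hv 0) (hv 1)
  · rw [bracketFamily_of_ne_one l hn]
    exact zero_mem _

theorem lieDiff_bracketFamily [DirectSum.Decomposition 𝒱] :
    lieDiff 𝒱 l (bracketFamily l) = 0 := by
  funext n
  match n with
  | 0 => rfl
  | m + 1 =>
    change lieCoboundary 𝒱 l (bracketFamily l m) = 0
    obtain rfl | hm := eq_or_ne m 1
    · refine multilinear_ext_homogeneous 𝒱 fun a v hv => ?_
      have jacobi := hl.sum_unshuffles_bracket_bracket hv
      rw [lieCoboundary_apply 𝒱 l _ hv]
      exact (congrArg₂ (fun x y => x - (-1 : ℤˣ) ^ 1 • y) jacobi jacobi).trans (by simp)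
    · rw [bracketFamily_of_ne_one l hm]
      exact congrFun (map_zero (lieDiff 𝒱 l)) (m + 1)

theorem exists_lInfinityStructure [CharZero k] [DirectSum.Decomposition 𝒱] :
    ∃ D : LInfinityStructure 𝒱, D.IsInducedBy l := by
  obtain ⟨D, hD, hDl⟩ := exists_coderivation hl.bracketFamily_mem_cochains
  have hDb : IsBracketCoderivation l D :=
    ⟨hD, fun v => by rw [hDl, bracketFamily_one],
      fun n hn => by rw [hDl, bracketFamily_of_ne_one l hn]⟩
  have two_D_sq : D ∘ₗ D + D ∘ₗ D = 0 := by
    have h := (hD.commutator hD).eq_zero_of_structureMaps_eq_zero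
      (by rw [mul_one, hDb.structureMaps_commutator hD, hDl, hl.lieDiff_bracketFamily])
    rwa [mul_one, uzpow_one, Units.neg_smul, one_smul, sub_neg_eq_add] at h
  have D_sq : D ∘ₗ D = 0 := by
    rwa [← two_smul k, smul_eq_zero_iff_right two_ne_zero] at two_D_sq
  exact ⟨⟨D, hD, D_sq⟩, hDb.structureMaps_one, hDb.structureMaps_of_ne_one⟩

end IsLieSuperalgebra

end Existence

/-! ### Infinitesimal deformations as coderivations -/

section Parameter

variable {k M : Type*} [Field k] [AddCommGroup M] [Module k M] (p q : ZMod 2)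

/-- The homomorphism `A + t B : M[t] → M[t]` of parity `q` over `k[t]`, for `A` of parity `q` and
`B` of parity `p + q`: it sends `x + t y` to `A x + t (B x + (-1)^{p q} A y)`. -/
def tExtend (A B : M →ₗ[k] M) : M × M →ₗ[k] M × M :=
  (A ∘ₗ LinearMap.fst k M M).prod
    (B ∘ₗ LinearMap.fst k M M + (-1 : ℤˣ) ^ (p * q) • A ∘ₗ LinearMap.snd k M M)

variable {p q} {A A' B B' : M →ₗ[k] M}

theorem tExtend_apply (x y : M) :
    tExtend p q A B (x, y) = (A x, B x + (-1 : ℤˣ) ^ (p * q) • A y) :=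
  rfl

theorem tExtend_inl (x : M) : tExtend p q A B (x, 0) = (A x, B x) := by
  rw [tExtend_apply, map_zero, smul_zero, add_zero]

theorem tExtend_zero : tExtend p q (0 : M →ₗ[k] M) 0 = 0 := by
  ext <;> simp [tExtend_apply]

theorem tExtend_inj : tExtend p q A B = tExtend p q A' B' ↔ A = A' ∧ B = B' := by
  refine ⟨fun h => ?_, by rintro ⟨rfl, rfl⟩; rfl⟩
  have h_inl (x : M) : (A x, B x) = (A' x, B' x) := by rw [← tExtend_inl, h, tExtend_inl]
  exact ⟨LinearMap.ext fun x => congrArg Prod.fst (h_inl x),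
    LinearMap.ext fun x => congrArg Prod.snd (h_inl x)⟩

theorem tExtend_comp {q' : ZMod 2} : tExtend p q A B ∘ₗ tExtend p q' A' B' =
    tExtend p (q + q') (A ∘ₗ A') (B ∘ₗ A' + (-1 : ℤˣ) ^ (p * q) • A ∘ₗ B') := by
  refine LinearMap.ext fun ⟨x, y⟩ => Prod.ext rfl ?_
  simp only [LinearMap.comp_apply, tExtend_apply, LinearMap.add_apply, LinearMap.smul_apply,
    map_add, LinearMap.map_smul_of_tower, smul_add, smul_smul, mul_add, uzpow_add, add_assoc]

variable {ℳ : ZMod 2 → Submodule k M}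

theorem IsTLinear.eq_tExtend {F : M × M →ₗ[k] M × M} (hF : IsTLinear p ℳ q F)
    (h : ∀ x, F (x, 0) = (A x, B x)) : F = tExtend p q A B := by
  refine LinearMap.ext fun ⟨x, y⟩ => ?_
  have h_tMul : F (0, y) = (-1 : ℤˣ) ^ (p * q) • (0, A y) := by
    simpa only [tMul, LinearMap.comp_apply, LinearMap.fst_apply, LinearMap.inr_apply, h]
      using hF.map_tMul (y, 0)
  rw [← Prod.fst_add_snd (x, y), map_add, h, h_tMul, tExtend_apply]
  simp [Prod.smul_mk]

theorem isTLinear_tExtend_iff :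
    IsTLinear p ℳ q (tExtend p q A B) ↔ HasParity ℳ ℳ q A ∧ HasParity ℳ ℳ (p + q) B := by
  constructor
  · intro h
    have h_inl (i : ZMod 2) (x : M) (hx : x ∈ ℳ i) := h.map_parity i (x, 0) ⟨hx, zero_mem _⟩
    simp only [tExtend_inl] at h_inl
    refine ⟨fun i x hx => (h_inl i x hx).1, fun i x hx => ?_⟩
    rw [add_comm p, ← add_assoc]
    exact (h_inl i x hx).2
  · rintro ⟨hA, hB⟩
    refine ⟨fun i ⟨x, y⟩ ⟨hx, hy⟩ => ?_, fun ⟨x, y⟩ => by simp [tMul, tExtend_apply, Prod.smul_mk]⟩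
    rw [tExtend_apply]
    refine ⟨hA i x hx, add_mem ?_ (Submodule.smul_of_tower_mem _ _ ?_)⟩
    · rw [add_assoc, add_comm q]
      exact hB i x hx
    · rw [add_right_comm]
      exact hA _ y hy

variable [DirectSum.Decomposition ℳ]

variable (ℳ A B) in
theorem tDerivation_tExtend : tDerivation p ℳ q (tExtend p q A B) =
    (tensorDerivation ℳ q A).prod (tensorDerivation ℳ (p + q) B) :=
  TensorProduct.ext' fun x y => by
    simp [tDerivation, tTensor, tExtend_inl, koszul_koszul, tensorDerivation_tmul]

variable (ℳ B) in
theorem tSquare_tExtend_id : tSquare p ℳ (tExtend p 0 LinearMap.id B) =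
    LinearMap.id.prod (tensorDerivation ℳ p B) :=
  TensorProduct.ext' fun x y => by simp [tSquare, tTensor, tExtend_inl, tensorDerivation_tmul]

end Parameter

section Deformations

variable {k V : Type*} [Field k] [CharZero k] [AddCommGroup V] [Module k V]
variable {𝒱 : ZMod 2 → Submodule k V} [DirectSum.Decomposition 𝒱]

namespace LInfinityStructure

variable (D : LInfinityStructure 𝒱) {p q : ZMod 2} {δ δ' β : SymRev 𝒱 →ₗ[k] SymRev 𝒱}

theorem isCoderivation_coboundary (h : IsCoderivation (parityRev 𝒱) q δ) :
    IsCoderivation (parityRev 𝒱) (q + 1) (D.coboundary q δ) := by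
  simpa only [coboundary, mul_one] using h.commutator D.isCoderivation

theorem coboundary_coboundary (q : ZMod 2) (δ : SymRev 𝒱 →ₗ[k] SymRev 𝒱) :
    D.coboundary (q + 1) (D.coboundary q δ) = 0 := by
  ext x
  have h_sq (y) : D.d (D.d y) = 0 := LinearMap.congr_fun D.sq_zero y
  simp [coboundary, h_sq, uzpow_add]

theorem tExtend_comp_tExtend_eq_zero_iff :
    tExtend p 1 D.d δ ∘ₗ tExtend p 1 D.d δ = 0 ↔ D.coboundary (p + 1) δ = 0 := by
  rw [tExtend_comp, D.sq_zero, ← tExtend_zero, tExtend_inj, and_iff_right rfl, mul_one,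
    coboundary, uzpow_add, uzpow_one, mul_neg_one, Units.neg_smul, sub_neg_eq_add]

theorem tExtend_id_comp_tExtend_eq_iff :
    tExtend p 0 LinearMap.id β ∘ₗ tExtend p 1 D.d δ =
        tExtend p 1 D.d δ' ∘ₗ tExtend p 0 LinearMap.id β ↔ δ' - δ = D.coboundary p β := by
  rw [tExtend_comp, tExtend_comp, add_comm 0 1, LinearMap.id_comp, LinearMap.comp_id, tExtend_inj,
    and_iff_right rfl, mul_zero, mul_one, uzpow_zero, one_smul, LinearMap.comp_id,
    LinearMap.id_comp, coboundary, sub_eq_sub_iff_add_eq_add, eq_comm]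

end LInfinityStructure

namespace InfDeformation

variable {D : LInfinityStructure 𝒱} {p : ZMod 2}

/-- The coderivation `δ` with `D_t = D + t δ`. -/
def increment (F : InfDeformation D p) : SymRev 𝒱 →ₗ[k] SymRev 𝒱 :=
  LinearMap.snd k _ _ ∘ₗ F.d ∘ₗ LinearMap.inl k _ _

theorem d_eq_tExtend (F : InfDeformation D p) : F.d = tExtend p 1 D.d F.increment :=
  F.isTLinear.eq_tExtend fun x => Prod.ext (F.reduces x) rfl

theorem increment_injective :
    Function.Injective (increment : InfDeformation D p → SymRev 𝒱 →ₗ[k] SymRev 𝒱) := by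
  intro F F' h
  have h_d : F.d = F'.d := by rw [d_eq_tExtend, h, ← d_eq_tExtend]
  cases F
  cases F'
  congr

theorem isCoderivation_increment (F : InfDeformation D p) :
    IsCoderivation (parityRev 𝒱) (p + 1) F.increment where
  map_parity := (isTLinear_tExtend_iff.mp (F.d_eq_tExtend ▸ F.isTLinear)).2
  map_one := congrArg Prod.snd F.map_one
  comul_comp := LinearMap.ext fun x => by
    have h := F.comul_comp x
    rw [F.d_eq_tExtend, tDerivation_tExtend, tExtend_inl] at h
    exact congrArg Prod.snd h

theorem coboundary_increment (F : InfDeformation D p) : D.coboundary (p + 1) F.increment = 0 :=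
  D.tExtend_comp_tExtend_eq_zero_iff.mp (F.d_eq_tExtend ▸ F.sq_zero)

/-- The infinitesimal deformation `D + t δ`. -/
def ofIncrement (δ : SymRev 𝒱 →ₗ[k] SymRev 𝒱) (hδ : IsCoderivation (parityRev 𝒱) (p + 1) δ)
    (h_cocycle : D.coboundary (p + 1) δ = 0) : InfDeformation D p where
  d := tExtend p 1 D.d δ
  isTLinear := isTLinear_tExtend_iff.mpr ⟨D.isCoderivation.map_parity, hδ.map_parity⟩
  map_one := by rw [tExtend_inl, D.isCoderivation.map_one, hδ.map_one, Prod.mk_zero_zero]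
  comul_comp x := by
    rw [tDerivation_tExtend, tExtend_inl]
    exact Prod.ext (LinearMap.congr_fun D.isCoderivation.comul_comp x)
      (LinearMap.congr_fun hδ.comul_comp x)
  sq_zero := D.tExtend_comp_tExtend_eq_zero_iff.mpr h_cocycle
  reduces _ := rfl

theorem increment_ofIncrement {δ : SymRev 𝒱 →ₗ[k] SymRev 𝒱}
    (hδ : IsCoderivation (parityRev 𝒱) (p + 1) δ) (h_cocycle : D.coboundary (p + 1) δ = 0) :
    (ofIncrement δ hδ h_cocycle).increment = δ :=
  LinearMap.ext fun x => congrArg Prod.snd (tExtend_inl (p := p) (q := 1) (A := D.d) x)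

variable {F F' : InfDeformation D p}

theorem Equivalent.exists_increment_sub_eq_coboundary (h : F.Equivalent F') :
    ∃ β, IsCoderivation (parityRev 𝒱) p β ∧ F'.increment - F.increment = D.coboundary p β := by
  obtain ⟨ρ, hρ_linear, hρ_one, hρ_comul, hρ_reduces, hρ_d⟩ := h
  set β : SymRev 𝒱 →ₗ[k] SymRev 𝒱 := LinearMap.snd k _ _ ∘ₗ ρ.toLinearMap ∘ₗ LinearMap.inl k _ _
  have hρ : ρ.toLinearMap = tExtend p 0 LinearMap.id β :=
    hρ_linear.eq_tExtend fun x => Prod.ext (hρ_reduces x) rfl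
  rw [hρ, F.d_eq_tExtend, F'.d_eq_tExtend] at hρ_d
  refine ⟨β, ⟨?_, congrArg Prod.snd hρ_one, LinearMap.ext fun x => ?_⟩,
    D.tExtend_id_comp_tExtend_eq_iff.mp hρ_d⟩
  · rw [hρ, isTLinear_tExtend_iff, add_zero] at hρ_linear
    exact hρ_linear.2
  · have h_comul := hρ_comul x
    rw [hρ, tSquare_tExtend_id] at h_comul
    exact congrArg Prod.snd h_comul

theorem equivalent_of_increment_sub_eq_coboundary {β : SymRev 𝒱 →ₗ[k] SymRev 𝒱}
    (hβ : IsCoderivation (parityRev 𝒱) p β) (h : F'.increment - F.increment = D.coboundary p β) :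
    F.Equivalent F' := by
  let ρ := (LinearEquiv.refl k (SymRev 𝒱)).skewProd (LinearEquiv.refl k (SymRev 𝒱)) β
  have hρ_apply (x : SymRev 𝒱) : ρ (x, 0) = (x, β x) := by simp [ρ]
  have hρ : ρ.toLinearMap = tExtend p 0 LinearMap.id β :=
    LinearMap.ext fun z => by simp [ρ, tExtend, add_comm]
  refine ⟨ρ, ?_, ?_, fun x => ?_, fun x => congrArg Prod.fst (hρ_apply x), ?_⟩
  · rw [hρ, isTLinear_tExtend_iff, add_zero]
    exact ⟨fun i x hx => by rwa [add_zero], hβ.map_parity⟩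
  · rw [hρ_apply, hβ.map_one]
  · rw [hρ, tSquare_tExtend_id, hρ_apply]
    exact Prod.ext rfl (LinearMap.congr_fun hβ.comul_comp x)
  · rw [hρ, F.d_eq_tExtend, F'.d_eq_tExtend]
    exact D.tExtend_id_comp_tExtend_eq_iff.mpr h

end InfDeformation
end Deformations

/-! ### Classification of infinitesimal deformations -/

section Classification

variable {k V : Type*} [Field k] [CharZero k] [AddCommGroup V] [Module k V]
variable {𝒱 : ZMod 2 → Submodule k V} [DirectSum.Decomposition 𝒱]
variable {l : V →ₗ[k] V →ₗ[k] V} {D : LInfinityStructure 𝒱}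

namespace LInfinityStructure.IsInducedBy

theorem isBracketCoderivation (hD : D.IsInducedBy l) : IsBracketCoderivation l D.d :=
  ⟨D.isCoderivation, hD.1, hD.2⟩

theorem unique {D' : LInfinityStructure 𝒱} (hD : D.IsInducedBy l) (hD' : D'.IsInducedBy l) :
    D = D' := by
  have h_d : D.d = D'.d := by
    refine D.isCoderivation.eq_of_structureMaps_eq D'.isCoderivation (funext fun n => ?_)
    obtain rfl | hn := eq_or_ne n 1
    · ext v
      rw [hD.1, hD'.1]
    · rw [hD.2 n hn, hD'.2 n hn]
  cases D
  cases D'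
  congr

variable {q : ZMod 2} {δ : SymRev 𝒱 →ₗ[k] SymRev 𝒱}

theorem structureMaps_coboundary (hD : D.IsInducedBy l) (hδ : IsCoderivation (parityRev 𝒱) q δ) :
    structureMaps 𝒱 (D.coboundary q δ) = lieDiff 𝒱 l (structureMaps 𝒱 δ) :=
  hD.isBracketCoderivation.structureMaps_commutator hδ

theorem coboundary_eq_zero_iff (hD : D.IsInducedBy l) (hδ : IsCoderivation (parityRev 𝒱) q δ) :
    D.coboundary q δ = 0 ↔ structureMaps 𝒱 δ ∈ lieCocycles 𝒱 l q := by
  rw [lieCocycles, Submodule.mem_inf, LinearMap.mem_ker, ← hD.structureMaps_coboundary hδ,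
    and_iff_right (structureMaps_mem_cochains hδ)]
  exact ⟨fun h => by rw [h, structureMaps_zero],
    (D.isCoderivation_coboundary hδ).eq_zero_of_structureMaps_eq_zero⟩

theorem mem_lieCoboundaries_iff (hD : D.IsInducedBy l) {φ : Family k V} :
    φ ∈ lieCoboundaries 𝒱 l (q + 1) ↔
      ∃ β, IsCoderivation (parityRev 𝒱) q β ∧ structureMaps 𝒱 (D.coboundary q β) = φ := by
  rw [lieCoboundaries, add_assoc, CharTwo.add_self_eq_zero, add_zero]
  constructor
  · rintro ⟨ψ, hψ, rfl⟩
    obtain ⟨β, hβ, rfl⟩ := exists_coderivation hψ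
    exact ⟨β, hβ, hD.structureMaps_coboundary hβ⟩
  · rintro ⟨β, hβ, rfl⟩
    exact ⟨structureMaps 𝒱 β, structureMaps_mem_cochains hβ, (hD.structureMaps_coboundary hβ).symm⟩

theorem lieCoboundaries_le (hD : D.IsInducedBy l) (q : ZMod 2) :
    lieCoboundaries 𝒱 l q ≤ lieCocycles 𝒱 l q := by
  intro φ hφ
  obtain ⟨q, rfl⟩ : ∃ r, q = r + 1 := ⟨q - 1, (sub_add_cancel q 1).symm⟩
  obtain ⟨β, hβ, rfl⟩ := hD.mem_lieCoboundaries_iff.mp hφ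
  exact (hD.coboundary_eq_zero_iff (D.isCoderivation_coboundary hβ)).mp
    (D.coboundary_coboundary q β)

end LInfinityStructure.IsInducedBy

namespace InfDeformation

variable {p : ZMod 2}

theorem cochain_mem (hD : D.IsInducedBy l) (F : InfDeformation D p) :
    F.cochain ∈ lieCocycles 𝒱 l (p + 1) :=
  (hD.coboundary_eq_zero_iff F.isCoderivation_increment).mp F.coboundary_increment

theorem cochain_injective : Function.Injective (cochain : InfDeformation D p → Family k V) :=
  fun F F' h => increment_injective
    (F.isCoderivation_increment.eq_of_structureMaps_eq F'.isCoderivation_increment h)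

theorem exists_cochain_eq (hD : D.IsInducedBy l) {φ : Family k V}
    (hφ : φ ∈ lieCocycles 𝒱 l (p + 1)) : ∃ F : InfDeformation D p, F.cochain = φ := by
  obtain ⟨δ, hδ, rfl⟩ := exists_coderivation hφ.1
  have h_cocycle := (hD.coboundary_eq_zero_iff hδ).mpr hφ
  exact ⟨ofIncrement δ hδ h_cocycle,
    congrArg (structureMaps 𝒱) (increment_ofIncrement hδ h_cocycle)⟩

theorem equivalent_iff (hD : D.IsInducedBy l) (F F' : InfDeformation D p) :
    F.Equivalent F' ↔ F'.cochain - F.cochain ∈ lieCoboundaries 𝒱 l (p + 1) := by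
  have h_sub : structureMaps 𝒱 (F'.increment - F.increment) = F'.cochain - F.cochain :=
    structureMaps_sub _ _
  rw [hD.mem_lieCoboundaries_iff, ← h_sub]
  constructor
  · intro h
    obtain ⟨β, hβ, h_incr⟩ := h.exists_increment_sub_eq_coboundary
    exact ⟨β, hβ, by rw [h_incr]⟩
  · rintro ⟨β, hβ, h_maps⟩
    exact equivalent_of_increment_sub_eq_coboundary hβ <|
      (F'.isCoderivation_increment.sub F.isCoderivation_increment).eq_of_structureMaps_eq
        (D.isCoderivation_coboundary hβ) h_maps.symm

theorem equivalence (hD : D.IsInducedBy l) : Equivalence (Equivalent (D := D) (p := p)) where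
  refl F := by
    rw [equivalent_iff hD, sub_self]
    exact zero_mem _
  symm h := by
    rw [equivalent_iff hD] at h ⊢
    rw [← neg_sub]
    exact neg_mem h
  trans h h' := by
    rw [equivalent_iff hD] at h h' ⊢
    rw [← sub_add_sub_cancel]
    exact add_mem h' h

/-- The correspondence `D_t = D + t δ ↦ φ` between infinitesimal deformations and cocycles. -/
def equivCocycles (hD : D.IsInducedBy l) : InfDeformation D p ≃ lieCocycles 𝒱 l (p + 1) :=
  Equiv.ofBijective (fun F => ⟨F.cochain, F.cochain_mem hD⟩)
    ⟨fun _ _ h => cochain_injective (congrArg Subtype.val h), fun φ =>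
      (exists_cochain_eq hD φ.2).imp fun _ h => Subtype.ext h⟩

/-- The correspondence between cohomology classes and classes of infinitesimal deformations induced
by `equivCocycles`. -/
def equivCohomology (hD : D.IsInducedBy l) :
    LieCohomology 𝒱 l (p + 1) ≃ Quot (Equivalent (D := D) (p := p)) :=
  (Quot.congr (equivCocycles hD) fun F F' => by
    rw [equivalent_iff hD, ← neg_mem_iff, neg_sub, Submodule.quotientRel_def]
    rfl).symm

theorem equivCohomology_mk (hD : D.IsInducedBy l) (F : InfDeformation D p) :
    equivCohomology hD (Submodule.Quotient.mk ⟨F.cochain, F.cochain_mem hD⟩) = Quot.mk _ F :=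
  (Equiv.symm_apply_eq _).mpr rfl

end InfDeformation
end Classification

end SuperLie

end

theorem mainTheorem5 {k V : Type*} [Field k] [CharZero k] [AddCommGroup V] [Module k V]
    (𝒱 : ZMod 2 → Submodule k V) [DirectSum.Decomposition 𝒱]
    (l : V →ₗ[k] V →ₗ[k] V) (hl : IsLieSuperalgebra 𝒱 l) :
    (∃! D : LInfinityStructure 𝒱, D.IsInducedBy l) ∧
    ∀ D : LInfinityStructure 𝒱, D.IsInducedBy l →
      (∀ q : ZMod 2,
        Set.BijOn (structureMaps 𝒱) {δ | IsCoderivation (parityRev 𝒱) q δ} (cochains 𝒱 q) ∧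
        (∀ δ, IsCoderivation (parityRev 𝒱) q δ →
          IsCoderivation (parityRev 𝒱) (q + 1) (D.coboundary q δ) ∧
          structureMaps 𝒱 (D.coboundary q δ) = lieDiff 𝒱 l (structureMaps 𝒱 δ)) ∧
        lieCoboundaries 𝒱 l q ≤ lieCocycles 𝒱 l q) ∧
      ∀ p : ZMod 2,
        Equivalence (InfDeformation.Equivalent (D := D) (p := p)) ∧
        (∀ φ ∈ lieCocycles 𝒱 l (p + 1), ∃! F : InfDeformation D p, F.cochain = φ) ∧
        ∃ (hc : ∀ F : InfDeformation D p, F.cochain ∈ lieCocycles 𝒱 l (p + 1))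
          (e : LieCohomology 𝒱 l (p + 1) ≃ Quot (InfDeformation.Equivalent (D := D) (p := p))),
          ∀ F : InfDeformation D p,
            e (Submodule.Quotient.mk ⟨F.cochain, hc F⟩) = Quot.mk _ F := by
  refine ⟨?_, fun D hD => ⟨fun q => ⟨bijOn_structureMaps q, fun δ hδ =>
    ⟨D.isCoderivation_coboundary hδ, hD.structureMaps_coboundary hδ⟩, hD.lieCoboundaries_le q⟩,
    fun p => ⟨InfDeformation.equivalence hD, fun φ hφ => ?_, fun F => F.cochain_mem hD,
      InfDeformation.equivCohomology hD, InfDeformation.equivCohomology_mk hD⟩⟩⟩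
  · obtain ⟨D, hD⟩ := hl.exists_lInfinityStructure
    exact ⟨D, hD, fun D' hD' => hD'.unique hD⟩
  · obtain ⟨F, hF⟩ := InfDeformation.exists_cochain_eq hD hφ
    exact ⟨F, hF, fun F' hF' => InfDeformation.cochain_injective (hF'.trans hF.symm)⟩
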